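/- Let $X$ be a Cantor space, that is, a nonempty, zero-dimensional, perfect, compact metrizable space. Equip the group $\mathrm{Homeo}(X)$ of homeomorphisms of $X$ with the topology whose basic open sets are $\{g : g(U_i)=V_i \text{ for } i=1,\dots,n\}$, where $n\in\mathbb N$ and the $U_i,V_i$ are clopen subsets of $X$. (1) Let $\varphi$ be a minimal homeomorphism of $X$ (every $\varphi$-orbit is dense) that is uniquely ergodic (there is exactly one $\varphi$-invariant Borel probability measure on $X$), and let $[\varphi]=\{g\in\mathrm{Homeo}(X) : \forall x\in X\ \exists n\in\mathbb Z\ \ g(x)=\varphi^n(x)\}$ be its full group. Then the set $\{g\in[\varphi] : g \text{ has finite order}\}$ is dense in $[\varphi]$. (2) Let $\mu$ be a good measure on $X$, that is, an atomless Borel probability measure with full support such that whenever $A,B\subseteq X$ are clopen and $\mu(A)\le\mu(B)$, there is a clopen $C\subseteq B$ with $\mu(C)=\mu(A)$. Then every partial $\mu$-automorphism of a finite algebra of clopen sets extends to a $\mu$-automorphism of a larger finite algebra: if $\mathcal A$ is a finite subalgebra of the Boolean algebra $\mathrm{Clop}(X)$ of clopen subsets of $X$, $\mathcal C,\mathcal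 D$ are subalgebras of $\mathcal A$, and $f:\mathcal C\to\mathcal D$ is a Boolean algebra isomorphism with $\mu(f(C))=\mu(C)$ for all $C\in\mathcal C$, then there are a finite subalgebra $\mathcal B\supseteq\mathcal A$ of $\mathrm{Clop}(X)$ and a Boolean algebra automorphism $g$ of $\mathcal B$ with $\mu(g(B))=\mu(B)$ for all $B\in\mathcal B$ and $g(C)=f(C)$ for all $C\in\mathcal C$. -/

import Mathlib

open MeasureTheory TopologicalSpace

universe u

namespace CantorDynamics

/-- A Cantor space: a nonempty, zero-dimensional, perfect, compact metrizable space. -/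
structure IsCantorSpace (X : Type u) [TopologicalSpace X] : Prop where
  nonempty : Nonempty X
  compact : CompactSpace X
  metrizable : MetrizableSpace X
  perfect : PerfectSpace X
  zeroDim : IsTopologicalBasis {s : Set X | IsClopen s}

/-- The topology on the homeomorphism group whose basic open sets are the sets
`{g | g(U₁) = V₁, …, g(Uₙ) = Vₙ}` with `Uᵢ`, `Vᵢ` clopen. -/
instance homeoTopology (X : Type u) [TopologicalSpace X] : TopologicalSpace (X ≃ₜ X) :=
  generateFrom {S | ∃ U V : Set X, IsClopen U ∧ IsClopen V ∧ S = {g : X ≃ₜ X | g '' U = V}}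

/-- The full group `[φ]`: the homeomorphisms mapping every point into its own `φ`-orbit. -/
def fullGroup {X : Type u} [TopologicalSpace X] (φ : X ≃ₜ X) : Subgroup (X ≃ₜ X) where
  carrier := {g | ∀ x, ∃ n : ℤ, g x = (φ ^ n) x}
  one_mem' := fun x => ⟨0, by simp⟩
  mul_mem' := by
    intro a b ha hb x
    obtain ⟨n, hn⟩ := hb x
    obtain ⟨m, hm⟩ := ha (b x)
    exact ⟨m + n, by rw [Homeomorph.mul_apply, hm, hn, zpow_add, Homeomorph.mul_apply]⟩
  inv_mem' := by
    intro a ha x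
    obtain ⟨n, hn⟩ := ha (a⁻¹ x)
    refine ⟨-n, ?_⟩
    have h1 : a (a⁻¹ x) = x := by rw [← Homeomorph.mul_apply, mul_inv_cancel, Homeomorph.one_apply]
    have h2 : (φ ^ (-n)) ((φ ^ n) (a⁻¹ x)) = a⁻¹ x := by
      rw [← Homeomorph.mul_apply, ← zpow_add, neg_add_cancel, zpow_zero, Homeomorph.one_apply]
    rw [← hn, h1] at h2
    exact h2.symm

/-- `φ` is minimal: every `φ`-orbit is dense. -/
def IsMinimalHomeo {X : Type u} [TopologicalSpace X] (φ : X ≃ₜ X) : Prop :=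
  ∀ x : X, Dense (Set.range fun n : ℤ => (φ ^ n) x)

/-- `φ` is uniquely ergodic: it has exactly one invariant Borel probability measure. -/
def IsUniquelyErgodic {X : Type u} [TopologicalSpace X] [MeasurableSpace X] (φ : X ≃ₜ X) : Prop :=
  ∃! μ : Measure X, IsProbabilityMeasure μ ∧ MeasurePreserving φ μ μ

/-- A good measure: an atomless probability measure of full support such that every clopen `B`
with `μ A ≤ μ B`, `A` clopen, has a clopen subset of measure `μ A`. -/
structure IsGoodMeasure {X : Type u} [TopologicalSpace X] [MeasurableSpace X]
    (μ : Measure X) : Prop where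
  isProbability : IsProbabilityMeasure μ
  atomless : ∀ x : X, μ {x} = 0
  fullSupport : ∀ U : Set X, IsOpen U → U.Nonempty → 0 < μ U
  subset_property : ∀ A B : Set X, IsClopen A → IsClopen B → μ A ≤ μ B →
    ∃ C : Set X, IsClopen C ∧ C ⊆ B ∧ μ C = μ A

/-- An isomorphism between two algebras of clopen sets preserves `μ`. (Order isomorphisms between
Boolean algebras are the same as isomorphisms of Boolean algebras.) -/
def PreservesMeasure {X : Type u} [TopologicalSpace X] [MeasurableSpace X] (μ : Measure X)
    {C D : BooleanSubalgebra (Clopens X)} (f : C ≃o D) : Prop :=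
  ∀ c : C, μ ((f c : Clopens X) : Set X) = μ ((c : Clopens X) : Set X)

/-- Every partial `μ`-automorphism of a finite algebra `A` of clopen sets, that is, every
`μ`-preserving isomorphism `f` between subalgebras `C`, `D` of `A`, extends to a
`μ`-automorphism of a finite algebra `B` of clopen sets containing `A`. -/
def PartialAutomorphismsExtend {X : Type u} [TopologicalSpace X] [MeasurableSpace X]
    (μ : Measure X) : Prop :=
  ∀ A C D : BooleanSubalgebra (Clopens X), (A : Set (Clopens X)).Finite →
    ∀ (hC : C ≤ A) (_ : D ≤ A) (f : C ≃o D), PreservesMeasure μ f →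
      ∃ (B : BooleanSubalgebra (Clopens X)) (hB : A ≤ B) (g : B ≃o B),
        (B : Set (Clopens X)).Finite ∧ PreservesMeasure μ g ∧
          ∀ c : C, (g ⟨(c : Clopens X), hB (hC c.2)⟩ : Clopens X) = (f c : Clopens X)

end CantorDynamics

/-!
# Finite approximation in full groups and for good measures on a Cantor space

Both statements rest on the combinatorial lemma `IsGoodMeasure.exists_refinement_perm`. Suppose the
pieces of a finite clopen partition carry two labellings by a finite set, and every label has the
same measure under both. The measures `x i` of the pieces then satisfy a finite system of linear
relations with integral coefficients. By `subdivides_of_relations`, a Euclidean algorithm with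
several numbers, they can be written `x i = ∑ m i l * y l` with clopen values `y l` and natural
numbers `m i l` satisfying the same relations for each `l`. A good measure realizes these
decompositions by clopen partitions. Among the resulting pieces of any given size each label occurs
equally often under both labellings, so that a permutation of the pieces, which preserves their
sizes, carries one labelling to the other.

A partial automorphism `f : C → D` of a finite algebra `A` labels an atom of `A` by the atom of `C`
containing it, and by the inverse image under `f` of the atom of `D` containing it. The lemma gives
a finite algebra containing `A` with a measure-preserving automorphism extending `f`.

Now let `φ` be minimal and uniquely ergodic, with invariant measure `μ`. By unique ergodicity, if
`μ A < μ B` some Birkhoff sum of `1_B - 1_A` is positive everywhere (`exists_birkhoffSum_pos`), and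
matching the points of `A` with points of `B` along orbits like brackets embeds `A` into `B` by a
locally constant power of `φ` (`exists_orbitEquiv_subset`). Hence `μ` is good. If `μ A = μ B`,
a back-and-forth construction exhausts `A` and `B` up to one point each, both in the same orbit, and
gives an orbit-preserving homeomorphism from `A` to `B` (`orbitEquiv_of_measure_eq`). Given `g` in
the full group and finitely many conditions `g '' U = V`, the combinatorial lemma provides a
permutation of the pieces of a clopen partition which satisfies the same conditions, and pieces of
equal measure being orbit equivalent, it is induced by an element of finite order of the full group
(`exists_isOfFinOrder_of_perm`).
-/

namespace CantorDynamics

/-! ### Simultaneous subdivision of finitely many nonnegative reals -/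

/-- `x` can be subdivided over `V` compatibly with the linear forms `P k`, `k ∈ s`: the numbers
`x i` are sums of elements `y l` of `V`, with multiplicities `m i l` which themselves satisfy the
homogeneous linear relations with coefficients `P k`. -/
def Subdivides {ι κ : Type*} [Fintype ι] (V : Set ℝ) (s : Set κ) (P : κ → ι → ℤ) (x : ι → ℝ) :
    Prop :=
  ∃ (y : ι → ℝ) (m : ι → ι → ℕ), (∀ l, y l ∈ V) ∧ (∀ i, x i = ∑ l, m i l * y l) ∧
    ∀ k ∈ s, ∀ l, ∑ i, P k i * (m i l : ℤ) = 0

/-- Subdivisions compose: if the `x i` are nonnegative integer combinations of the `x' j`, a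
subdivision of `x'` compatible with the transported relations yields one of `x`. -/
lemma Subdivides.trans {ι κ : Type*} [Fintype ι] {V : Set ℝ} {s : Set κ} {P P' : κ → ι → ℤ}
    {x x' : ι → ℝ} (n : ι → ι → ℕ) (hx : ∀ i, x i = ∑ j, n i j * x' j)
    (hP : ∀ k ∈ s, ∀ j, ∑ i, P k i * (n i j : ℤ) = P' k j) (h : Subdivides V s P' x') :
    Subdivides V s P x := by
  obtain ⟨y, m, hy, hm, hr⟩ := h
  refine ⟨y, fun i l => ∑ j, n i j * m j l, hy, fun i => ?_, fun k hk l => ?_⟩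
  · rw [hx i]
    simp only [hm, Nat.cast_sum, Nat.cast_mul, Finset.mul_sum, Finset.sum_mul]
    rw [Finset.sum_comm]
    simp only [mul_assoc]
  · rw [← hr k hk l]
    simp only [← hP k hk, Nat.cast_sum, Nat.cast_mul, Finset.mul_sum, Finset.sum_mul]
    rw [Finset.sum_comm]
    simp only [mul_assoc]

/-- The subtractive Euclidean step: if `x i ≤ x j`, write `x j = (x j - x i) + x i`. -/
lemma Subdivides.of_sub {ι : Type*} [Fintype ι] [DecidableEq ι] {V : Set ℝ} {p : ι → ℤ}
    {x : ι → ℝ} {i j : ι} (hij : i ≠ j)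
    (h : Subdivides V Set.univ (fun _ : Unit => Function.update p i (p i + p j))
      (Function.update x j (x j - x i))) :
    Subdivides V Set.univ (fun _ : Unit => p) x := by
  refine h.trans (fun a b => (if a = b then 1 else 0) + if a = j then if b = i then 1 else 0 else 0)
    (fun a => ?_) (fun _ _ b => ?_)
  · by_cases haj : a = j
    · subst haj
      simp [add_mul, Finset.sum_add_distrib, hij]
    · simp [haj]
  · by_cases hbi : b = i
    · subst hbi
      simp [mul_add, Finset.sum_add_distrib]
    · simp [hbi]

/-- A vanishing entry puts no constraint on its coefficient. -/
lemma Subdivides.of_eq_zero {ι : Type*} [Fintype ι] [DecidableEq ι] {V : Set ℝ} {p : ι → ℤ}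
    {x : ι → ℝ} {i : ι} (hi : x i = 0)
    (h : Subdivides V Set.univ (fun _ : Unit => Function.update p i 0) x) :
    Subdivides V Set.univ (fun _ : Unit => p) x := by
  refine h.trans (fun a b => if a = b then if b = i then 0 else 1 else 0)
    (fun a => ?_) (fun _ _ b => ?_)
  · by_cases ha : a = i
    · subst ha; simp [hi]
    · simp [ha]
  · by_cases hb : b = i
    · subst hb; simp
    · simp [hb]

lemma Subdivides.of_neg {ι : Type*} [Fintype ι] {V : Set ℝ} {p : ι → ℤ} {x : ι → ℝ}
    (h : Subdivides V Set.univ (fun _ : Unit => -p) x) :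
    Subdivides V Set.univ (fun _ : Unit => p) x := by
  obtain ⟨y, m, hy, hm, hr⟩ := h
  refine ⟨y, m, hy, hm, fun k hk l => ?_⟩
  simpa using hr k hk l

lemma card_filter_update_lt {ι α : Type*} [Fintype ι] [DecidableEq ι] (q : α → Prop)
    [DecidablePred q] (p : ι → α) {i : ι} {v : α} (hi : q (p i)) (hv : ¬ q v) :
    (Finset.univ.filter fun a => q (Function.update p i v a)).card <
      (Finset.univ.filter fun a => q (p a)).card := by
  refine Finset.card_lt_card (Finset.ssubset_iff_subset_ne.2 ⟨fun a ha => ?_, fun h => ?_⟩)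
  · rw [Finset.mem_filter] at ha ⊢
    by_cases hai : a = i
    · subst hai; simp [hv] at ha
    · simpa [hai] using ha
  · have : i ∈ Finset.univ.filter fun a => q (p a) := by simp [hi]
    rw [← h] at this
    simp [hv] at this

/-- One linear relation. The induction is on the maximal absolute value of a coefficient, then on
the number of coefficients attaining it, then on the number of negative coefficients: a Euclidean
step between an entry with maximal coefficient and one with negative coefficient decreases this
triple. -/
lemma subdivides_of_relation {ι : Type*} [Fintype ι] {V : Set ℝ} (hV0 : ∀ v ∈ V, 0 ≤ v)
    (hV : ∀ u ∈ V, ∀ v ∈ V, u ≤ v → v - u ∈ V) (p : ι → ℤ) (x : ι → ℝ) (hx : ∀ i, x i ∈ V)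
    (h0 : ∑ i, (p i : ℝ) * x i = 0) : Subdivides V Set.univ (fun _ : Unit => p) x := by
  classical
  suffices H : ∀ (M N : ℕ) (p : ι → ℤ) (x : ι → ℝ), (∀ i, x i ∈ V) → ∑ i, (p i : ℝ) * x i = 0 →
      (∀ i, |p i| ≤ M) → (Finset.univ.filter fun i => |p i| = M).card ≤ N →
      Subdivides V Set.univ (fun _ : Unit => p) x by
    refine H (∑ i, (p i).natAbs) _ p x hx h0 (fun i => ?_) le_rfl
    rw [Int.abs_eq_natAbs]
    exact_mod_cast Finset.single_le_sum (f := fun i => (p i).natAbs) (fun _ _ => Nat.zero_le _)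
      (Finset.mem_univ i)
  intro M
  induction M with
  | zero =>
    intro N p x hx _ hM _
    refine ⟨x, fun a b => if a = b then 1 else 0, hx, by simp, fun _ _ l => ?_⟩
    have : ∀ i, p i = 0 := fun i => abs_eq_zero.1 (le_antisymm (by simpa using hM i) (abs_nonneg _))
    simp [this]
  | succ M ihM =>
  intro N
  induction N with
  | zero =>
    intro p x hx h0 hM hN
    refine ihM _ p x hx h0 (fun i => ?_) le_rfl
    have h1 : i ∉ Finset.univ.filter fun i => |p i| = ((M + 1 : ℕ) : ℤ) := by
      rw [Finset.card_eq_zero.1 (Nat.le_zero.1 hN)]; simp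
    have h2 := hM i
    simp only [Finset.mem_filter, Finset.mem_univ, true_and] at h1
    push_cast at h1 h2 ⊢
    omega
  | succ N ihN =>
  -- the case of a positive maximal coefficient at a fixed index `i`
  have inner : ∀ (i : ι) (K : ℕ) (p : ι → ℤ) (x : ι → ℝ), p i = (M + 1 : ℕ) → (∀ i, x i ∈ V) →
      ∑ i, (p i : ℝ) * x i = 0 → (∀ i, |p i| ≤ (M + 1 : ℕ)) →
      (Finset.univ.filter fun i => |p i| = ((M + 1 : ℕ) : ℤ)).card ≤ N + 1 →
      (Finset.univ.filter fun i => p i < 0).card ≤ K →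
      Subdivides V Set.univ (fun _ : Unit => p) x := by
    intro i K
    induction K with
    | zero =>
      intro p x hi hx h0 hM hN hK
      have hpos : ∀ j, 0 ≤ p j := by
        intro j
        have h1 : j ∉ Finset.univ.filter fun i => p i < 0 := by
          rw [Finset.card_eq_zero.1 (Nat.le_zero.1 hK)]; simp
        simpa using h1
      -- All terms of the relation are nonnegative, hence zero, so that `x i = 0`.
      have hz : (p i : ℝ) * x i = 0 :=
        (Finset.sum_eq_zero_iff_of_nonneg
          (fun j _ => mul_nonneg (by exact_mod_cast hpos j) (hV0 _ (hx j)))).1 h0 i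
          (Finset.mem_univ i)
      have hxi : x i = 0 := by
        rcases mul_eq_zero.1 hz with h | h
        · rw [hi] at h; norm_cast at h
        · exact h
      refine .of_eq_zero hxi (ihN _ x hx ?_ (fun a => ?_) ?_)
      · rw [← h0]
        refine Finset.sum_congr rfl fun a _ => ?_
        by_cases ha : a = i
        · subst ha; simp [hxi]
        · simp [ha]
      · by_cases ha : a = i
        · subst ha; simp; positivity
        · simpa [ha] using hM a
      · have := card_filter_update_lt (fun z : ℤ => |z| = ((M + 1 : ℕ) : ℤ)) p (i := i) (v := 0)
          (by rw [hi, Nat.abs_cast]) (by simp; omega)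
        omega
    | succ K ihK =>
      intro p x hi hx h0 hM hN hK
      by_cases hneg : (Finset.univ.filter fun i => p i < 0).card ≤ K
      · exact ihK p x hi hx h0 hM hN hneg
      obtain ⟨j, hj⟩ := Finset.card_pos.1
        (by omega : 0 < (Finset.univ.filter fun i => p i < 0).card)
      replace hj : p j < 0 := by simpa using hj
      have hij : i ≠ j := by rintro rfl; omega
      have hjM := hM j
      rw [abs_of_neg hj] at hjM
      -- invariance of the relation under a Euclidean step
      have key : ∀ a b : ι, a ≠ b → ∑ c, ((Function.update p a (p a + p b) c : ℤ) : ℝ) *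
          Function.update x b (x b - x a) c = 0 := by
        intro a b hab
        rw [← h0, ← sub_eq_zero, ← Finset.sum_sub_distrib]
        rw [← Finset.add_sum_erase _ _ (Finset.mem_univ a),
          ← Finset.add_sum_erase _ _ (Finset.mem_erase.2 ⟨hab.symm, Finset.mem_univ b⟩),
          Finset.sum_eq_zero]
        · simp [hab, hab.symm]; ring
        · intro c hc
          simp only [Finset.mem_erase, Finset.mem_univ, and_true] at hc
          simp [hc.1, hc.2]
      have keyV : ∀ a b : ι, x a ≤ x b → ∀ c, Function.update x b (x b - x a) c ∈ V := by
        intro a b hab c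
        by_cases hc : c = b
        · subst hc; simpa using hV _ (hx a) _ (hx c) hab
        · simpa [hc] using hx c
      have keyM : ∀ a b : ι, |p a + p b| ≤ (M + 1 : ℕ) →
          ∀ c, |Function.update p a (p a + p b) c| ≤ (M + 1 : ℕ) := by
        intro a b hab c
        by_cases hc : c = a
        · subst hc; simpa using hab
        · simpa [hc] using hM c
      have hsum : |p i + p j| ≤ M := by
        rw [abs_of_nonneg (by omega)]; push_cast at hi; omega
      -- If `x i ≤ x j`, the maximal coefficient `p i` is replaced by `p i + p j`, which is smaller.
      -- Otherwise the negative coefficient `p j` is replaced by `p i + p j`, which is nonnegative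
      -- and not maximal.
      rcases le_total (x i) (x j) with hle | hle
      · refine .of_sub hij (ihN _ _ (keyV i j hle) (key i j hij)
          (keyM i j (by push_cast; omega)) ?_)
        have := card_filter_update_lt (fun z : ℤ => |z| = ((M + 1 : ℕ) : ℤ)) p (i := i)
          (v := p i + p j) (by rw [hi, Nat.abs_cast]) (by push_cast; omega)
        omega
      · refine .of_sub hij.symm (ihK _ _ ?_ (keyV j i hle) (key j i hij.symm)
          (keyM j i (by rw [add_comm]; push_cast; omega)) ?_ ?_)
        · simpa [hij] using hi
        · refine le_trans (Finset.card_le_card fun a ha => ?_) hN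
          rw [Finset.mem_filter] at ha ⊢
          by_cases haj : a = j
          · subst haj
            have h1 := ha.2
            rw [Function.update_self, add_comm] at h1
            push_cast at h1
            omega
          · simpa [haj] using ha
        · have := card_filter_update_lt (fun z : ℤ => z < 0) p (i := j) (v := p j + p i) hj
            (by push_cast at hi; omega)
          omega
  intro p x hx h0 hM hN
  by_cases hN' : (Finset.univ.filter fun i => |p i| = ((M + 1 : ℕ) : ℤ)).card ≤ N
  · exact ihN p x hx h0 hM hN'
  obtain ⟨i, hi⟩ := Finset.card_pos.1
    (by omega : 0 < (Finset.univ.filter fun i => |p i| = ((M + 1 : ℕ) : ℤ)).card)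
  replace hi : |p i| = ((M + 1 : ℕ) : ℤ) := by simpa using hi
  rcases abs_choice (p i) with h | h
  · exact inner i _ p x (h ▸ hi) hx h0 hM hN le_rfl
  · refine .of_neg (inner i _ (-p) x (by simpa [← h] using hi) hx ?_ ?_ ?_ le_rfl)
    · simpa using h0
    · simpa using hM
    · simpa using hN

/-- Nonnegative reals from a set closed under subtraction of smaller elements can be subdivided
compatibly with all the homogeneous integral linear relations of a finite system which they
satisfy. This is the Shen property of the totally ordered group generated by `V`. -/
lemma subdivides_of_relations {ι κ : Type*} [Fintype ι] [Finite κ] {V : Set ℝ}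
    (hV0 : ∀ v ∈ V, 0 ≤ v) (hV : ∀ u ∈ V, ∀ v ∈ V, u ≤ v → v - u ∈ V) (P : κ → ι → ℤ)
    (x : ι → ℝ) (hx : ∀ i, x i ∈ V) (h0 : ∀ k, ∑ i, (P k i : ℝ) * x i = 0) :
    Subdivides V Set.univ P x := by
  classical
  refine Set.finite_univ.induction_on (motive := fun s _ => Subdivides V s P x) _ ?_ ?_
  · exact ⟨x, fun a b => if a = b then 1 else 0, hx, by simp, by simp⟩
  · rintro k s - - ⟨y, m, hy, hm, hr⟩
    obtain ⟨z, n, hz, hn, hq⟩ := subdivides_of_relation hV0 hV (fun l => ∑ i, P k i * (m i l : ℤ))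
      y hy (by
        rw [← h0 k]
        simp only [hm, Finset.mul_sum, Int.cast_sum, Finset.sum_mul]
        rw [Finset.sum_comm]
        simp [mul_assoc])
    refine Subdivides.trans (P' := fun k l => ∑ i, P k i * (m i l : ℤ)) m hm (fun _ _ _ => rfl)
      ⟨z, n, hz, hn, fun k' hk' l => ?_⟩
    rcases Set.mem_insert_iff.1 hk' with rfl | hk'
    · exact hq () trivial l
    · simp [hr k' hk']


lemma isClopen_preimage_of_finite {X : Type*} [TopologicalSpace X] {ι : Type*} [Finite ι]
    {a : X → ι} (ha : ∀ i, IsClopen (a ⁻¹' {i})) (S : Set ι) : IsClopen (a ⁻¹' S) := by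
  rw [← Set.biUnion_preimage_singleton]
  exact (Set.toFinite S).isClopen_biUnion fun i _ => ha i

section

variable {X : Type u} [TopologicalSpace X] [MeasurableSpace X]

/-! ### Measures of clopen sets -/

/-- The clopen value set of `μ`: the real numbers which are measures of clopen sets. -/
def clopenValues (μ : Measure X) : Set ℝ :=
  {v | ∃ U : Set X, IsClopen U ∧ μ.real U = v}

lemma IsGoodMeasure.exists_subset_real_eq {μ : Measure X} (hμ : IsGoodMeasure μ) {v : ℝ}
    (hv : v ∈ clopenValues μ) {B : Set X} (hB : IsClopen B) (h : v ≤ μ.real B) :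
    ∃ C : Set X, IsClopen C ∧ C ⊆ B ∧ μ.real C = v := by
  have := hμ.isProbability
  obtain ⟨U, hU, rfl⟩ := hv
  obtain ⟨C, hC, hCB, h1⟩ := hμ.subset_property U B hU hB
    ((ENNReal.toReal_le_toReal (measure_ne_top _ _) (measure_ne_top _ _)).1 h)
  exact ⟨C, hC, hCB, by rw [Measure.real, h1, Measure.real]⟩

lemma IsGoodMeasure.sub_mem_clopenValues [BorelSpace X] {μ : Measure X} (hμ : IsGoodMeasure μ)
    (u : ℝ) (hu : u ∈ clopenValues μ) (v : ℝ) (hv : v ∈ clopenValues μ) (huv : u ≤ v) :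
    v - u ∈ clopenValues μ := by
  have := hμ.isProbability
  obtain ⟨V, hV, rfl⟩ := hv
  obtain ⟨C, hC, hCV, rfl⟩ := hμ.exists_subset_real_eq hu hV huv
  exact ⟨V \ C, hV.diff hC, measureReal_sdiff hCV hC.isOpen.measurableSet⟩

lemma IsGoodMeasure.eq_empty_of_real_eq_zero {μ : Measure X} (hμ : IsGoodMeasure μ) {U : Set X}
    (hU : IsOpen U) (h : μ.real U = 0) : U = ∅ := by
  have := hμ.isProbability
  by_contra hne
  have := hμ.fullSupport U hU (Set.nonempty_iff_ne_empty.2 hne)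
  exact this.ne' ((measureReal_eq_zero_iff).1 h)

/-- A good measure admits clopen partitions with prescribed clopen values. -/
lemma IsGoodMeasure.exists_partition [BorelSpace X] {μ : Measure X} (hμ : IsGoodMeasure μ)
    {K : Type*} (s : Finset K) (v : K → ℝ) (hv : ∀ k, v k ∈ clopenValues μ) {B : Set X}
    (hB : IsClopen B) (h : μ.real B = ∑ k ∈ s, v k) :
    ∃ P : K → Set X, (∀ k ∈ s, IsClopen (P k)) ∧ (∀ k ∈ s, μ.real (P k) = v k) ∧
      (∀ k ∈ s, ∀ l ∈ s, k ≠ l → Disjoint (P k) (P l)) ∧ ⋃ k ∈ s, P k = B := by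
  classical
  have := hμ.isProbability
  have hv0 : ∀ k, 0 ≤ v k := fun k => by
    obtain ⟨U, -, hU⟩ := hv k
    exact hU ▸ measureReal_nonneg
  induction s using Finset.induction_on generalizing B with
  | empty =>
    exact ⟨fun _ => ∅, by simp, by simp, by simp,
      by simpa using (hμ.eq_empty_of_real_eq_zero hB.isOpen (by simpa using h)).symm⟩
  | insert a s ha ih =>
    rw [Finset.sum_insert ha] at h
    obtain ⟨C, hC, hCB, hCv⟩ := hμ.exists_subset_real_eq (hv a) hB
      (by rw [h]; linarith [Finset.sum_nonneg (s := s) fun k _ => hv0 k])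
    obtain ⟨P, h1, h2, h3, h4⟩ := ih (hB.diff hC)
      (by rw [measureReal_sdiff hCB hC.isOpen.measurableSet]; linarith)
    have hP : ∀ k ∈ s, P k ⊆ B \ C := fun k hk => h4 ▸ Set.subset_biUnion_of_mem hk
    have hne : ∀ k ∈ s, k ≠ a := fun k hk hka => ha (hka ▸ hk)
    have hd : ∀ k ∈ s, Disjoint C (P k) := fun k hk =>
      Set.disjoint_sdiff_right.mono_right (hP k hk)
    refine ⟨Function.update P a C, fun k hk => ?_, fun k hk => ?_, fun k hk l hl hkl => ?_, ?_⟩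
    · rcases Finset.mem_insert.1 hk with rfl | hk
      · simpa
      · simpa [hne k hk] using h1 k hk
    · rcases Finset.mem_insert.1 hk with rfl | hk
      · simpa
      · simpa [hne k hk] using h2 k hk
    · rcases Finset.mem_insert.1 hk with rfl | hk'
      · rcases Finset.mem_insert.1 hl with rfl | hl'
        · exact absurd rfl hkl
        · simpa [hne l hl'] using hd l hl'
      · rcases Finset.mem_insert.1 hl with rfl | hl'
        · simpa [hne k hk'] using (hd k hk').symm
        · simpa [hne k hk', hne l hl'] using h3 k hk' l hl' hkl
    · rw [Finset.set_biUnion_insert, Function.update_self,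
        show ⋃ k ∈ s, Function.update P a C k = B \ C from
          h4 ▸ Set.iUnion₂_congr fun k hk => by simp [hne k hk]]
      exact Set.union_sdiff_cancel hCB

/-- The measure of a union of fibres. -/
lemma measureReal_preimage_eq_sum [BorelSpace X] {μ : Measure X} [IsProbabilityMeasure μ]
    {ι : Type*} [Fintype ι] {a : X → ι} (ha : ∀ i, IsClopen (a ⁻¹' {i})) (S : Set ι)
    [DecidablePred (· ∈ S)] :
    μ.real (a ⁻¹' S) = ∑ i, if i ∈ S then μ.real (a ⁻¹' {i}) else 0 := by
  rw [← Finset.sum_filter, ← measureReal_biUnion_finset]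
  · congr 1; ext x; simp
  · intro i _ j _ hij
    exact Disjoint.preimage a (Set.disjoint_singleton.2 hij)
  · exact fun i _ => (ha i).isOpen.measurableSet

/-- **Equidecomposition by a permutation.** Let `a` be a finite clopen partition of `X`, and let
`c`, `d` be two labellings of its pieces such that each label gets the same measure under `c` and
under `d`. Then `a` has a finite clopen refinement `p` whose pieces are permuted, in a
measure-preserving way, so that the label `c` of a piece is the label `d` of its image.

Subdividing the measures of the pieces compatibly with the relations expressing the hypothesis,
one obtains a refinement into pieces of finitely many sizes, in which the label `k` occurs under
`c` as often as under `d` on the pieces of any given size. -/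
lemma IsGoodMeasure.exists_refinement_perm [BorelSpace X] {μ : Measure X} (hμ : IsGoodMeasure μ)
    {ι : Type u} {κ : Type*} [Finite ι] [Finite κ] {a : X → ι} (ha : ∀ i, IsClopen (a ⁻¹' {i}))
    (c d : ι → κ) (hcd : ∀ k, μ.real {x | c (a x) = k} = μ.real {x | d (a x) = k}) :
    ∃ (I : Type u) (_ : Finite I) (p : X → I) (q : I → ι) (σ : Equiv.Perm I),
      Function.Surjective p ∧ (∀ i, IsClopen (p ⁻¹' {i})) ∧ (∀ x, q (p x) = a x) ∧
      (∀ i, d (q (σ i)) = c (q i)) ∧ ∀ i, μ.real (p ⁻¹' {σ i}) = μ.real (p ⁻¹' {i}) := by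
  classical
  have := hμ.isProbability
  have := Fintype.ofFinite ι
  have := Fintype.ofFinite κ
  obtain ⟨y, m₀, hy, hm₀, hr₀⟩ := subdivides_of_relations (V := clopenValues μ)
    (by rintro _ ⟨U, -, rfl⟩; exact measureReal_nonneg) hμ.sub_mem_clopenValues
    (fun (k : κ) i => (if c i = k then 1 else 0) - (if d i = k then 1 else 0))
    (fun i => μ.real (a ⁻¹' {i})) (fun i => ⟨_, ha i, rfl⟩) (fun k => by
      have h1 := measureReal_preimage_eq_sum (μ := μ) ha {i | c i = k}
      have h2 := measureReal_preimage_eq_sum (μ := μ) ha {i | d i = k}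
      have h3 := hcd k
      simp only [Set.preimage_ofPred_eq, Set.mem_ofPred_eq] at h1 h2
      rw [h1, h2] at h3
      simp [sub_mul, Finset.sum_sub_distrib, h3])
  -- Sizes `y l = 0` are discarded, since they would give empty pieces.
  set m : ι → ι → ℕ := fun i l => if y l = 0 then 0 else m₀ i l with hm_def
  have hm : ∀ i, μ.real (a ⁻¹' {i}) = ∑ l, m i l * y l := fun i => by
    refine (hm₀ i).trans ?_
    refine Finset.sum_congr rfl fun l _ => ?_
    by_cases hl : y l = 0 <;> simp [hm_def, hl]
  have hr : ∀ k l, ∑ i, (if c i = k then m i l else 0) = ∑ i, (if d i = k then m i l else 0) := by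
    intro k l
    by_cases hl : y l = 0
    · simp [hm_def, hl]
    · have := hr₀ k trivial l
      simp only [sub_mul, Finset.sum_sub_distrib, ite_mul, one_mul, zero_mul] at this
      simp only [hm_def, hl, if_false]
      exact_mod_cast sub_eq_zero.1 this
  -- A piece is given by a piece `i` of `a`, a size `l`, and a number below `m i l`.
  let I := Σ i : ι, Σ l : ι, Fin (m i l)
  have hpart : ∀ i, ∃ P : (Σ l : ι, Fin (m i l)) → Set X, (∀ k, IsClopen (P k)) ∧
      (∀ k, μ.real (P k) = y k.1) ∧ (∀ k l, k ≠ l → Disjoint (P k) (P l)) ∧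
      ⋃ k, P k = a ⁻¹' {i} := fun i => by
    simpa using hμ.exists_partition (Finset.univ : Finset (Σ l : ι, Fin (m i l)))
      (fun k => y k.1) (fun k => hy k.1) (ha i) (by rw [hm i, Fintype.sum_sigma]; simp)
  choose P hP1 hP2 hP3 hP4 using hpart
  have hmem : ∀ x, ∃ k, x ∈ P (a x) k := fun x => by
    have : x ∈ ⋃ k, P (a x) k := by rw [hP4]; rfl
    simpa using this
  choose r hr' using hmem
  let p : X → I := fun x => ⟨a x, r x⟩
  have hp : ∀ i : I, p ⁻¹' {i} = P i.1 i.2 := by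
    rintro ⟨i, k⟩
    ext x
    constructor
    · intro hx
      have hx : p x = ⟨i, k⟩ := hx
      have h1 : x ∈ P (p x).1 (p x).2 := hr' x
      rwa [hx] at h1
    · intro hx
      have h1 : x ∈ a ⁻¹' {i} := by rw [← hP4]; exact Set.mem_iUnion.2 ⟨k, hx⟩
      obtain rfl : a x = i := h1
      have h2 : r x = k := by
        by_contra hne
        exact Set.disjoint_left.1 (hP3 _ _ _ hne) (hr' x) hx
      subst h2
      rfl
  -- The fibres of the two labellings by label and size are equinumerous.
  have hcard : ∀ (e : ι → κ) (z : κ × ι),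
      Fintype.card {i : I // ((e i.1, i.2.1) : κ × ι) = z} =
        ∑ i, if e i = z.1 then m i z.2 else 0 := by
    rintro e ⟨k, l⟩
    rw [Fintype.card_subtype, Finset.card_filter, Fintype.sum_sigma]
    refine Finset.sum_congr rfl fun i _ => ?_
    rw [Fintype.sum_sigma]
    by_cases hi : e i = k <;> simp [hi]
  obtain ⟨σ, hσ⟩ : ∃ σ : Equiv.Perm I,
      ∀ i : I, ((d (σ i).1, (σ i).2.1) : κ × ι) = (c i.1, i.2.1) :=
    have e : ∀ z, {i : I // ((c i.1, i.2.1) : κ × ι) = z} ≃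
        {i : I // ((d i.1, i.2.1) : κ × ι) = z} := fun z =>
      Fintype.equivOfCardEq (by rw [hcard, hcard, hr])
    ⟨Equiv.ofFiberEquiv e, Equiv.ofFiberEquiv_map e⟩
  refine ⟨I, inferInstance, p, fun i => i.1, σ, fun i => ?_, fun i => hp i ▸ hP1 _ _,
    fun x => rfl, fun i => congrArg Prod.fst (hσ i), fun i => ?_⟩
  · have hne : y i.2.1 ≠ 0 := by
      intro h0
      have h1 := i.2.2.pos
      simp [hm_def, h0] at h1
    have : (p ⁻¹' {i}).Nonempty := by
      rw [hp, Set.nonempty_iff_ne_empty]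
      intro h0
      rw [← hP2 i.1 i.2, h0] at hne
      simp at hne
    exact this
  · rw [hp, hp, hP2, hP2]
    exact congrArg (fun z => y z.2) (hσ i)

end


section

variable {X : Type u} [TopologicalSpace X] [MeasurableSpace X]

/-! ### Extension of partial automorphisms -/

/-- The clopen sets which are unions of fibres of `p`. -/
def fiberAlgebra {X : Type u} [TopologicalSpace X] {I : Type*} (p : X → I) :
    BooleanSubalgebra (Clopens X) where
  carrier := {b | ∃ S : Set I, (b : Set X) = p ⁻¹' S}
  supClosed' := by
    rintro _ ⟨S, hS⟩ _ ⟨T, hT⟩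
    exact ⟨S ∪ T, by rw [Clopens.coe_sup, hS, hT, Set.preimage_union]⟩
  infClosed' := by
    rintro _ ⟨S, hS⟩ _ ⟨T, hT⟩
    exact ⟨S ∩ T, by rw [Clopens.coe_inf, hS, hT, Set.preimage_inter]⟩
  compl_mem' := by
    rintro _ ⟨S, hS⟩
    exact ⟨Sᶜ, by rw [Clopens.coe_compl, hS, Set.preimage_compl]⟩
  bot_mem' := ⟨∅, by simp⟩

/-- If the fibres of the surjection `p` are clopen, `fiberAlgebra p` is the power set algebra. -/
def fiberAlgebraIso {X : Type u} [TopologicalSpace X] {I : Type*} [Finite I] {p : X → I}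
    (hp : Function.Surjective p) (hc : ∀ i, IsClopen (p ⁻¹' {i})) : Set I ≃o fiberAlgebra p where
  toFun S := ⟨⟨p ⁻¹' S, isClopen_preimage_of_finite hc S⟩, S, rfl⟩
  invFun b := p '' (b : Set X)
  left_inv S := Set.image_preimage_eq S hp
  right_inv := by
    rintro ⟨b, S, hS⟩
    apply Subtype.ext
    apply Clopens.ext
    change p ⁻¹' (p '' (b : Set X)) = b
    rw [hS, Set.image_preimage_eq S hp]
  map_rel_iff' := by
    intro S T
    exact hp.preimage_subset_preimage_iff

/-- An isomorphism of finite subalgebras which preserves measure preserves the measures of the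
atoms, here given as the sets of points lying in prescribed members of the algebra. -/
lemma PreservesMeasure.measure_setOf_eq {μ : Measure X} {C D : BooleanSubalgebra (Clopens X)}
    [Finite C] {f : C ≃o D} (hf : PreservesMeasure μ f) (k : Set C) :
    μ {x | {u : C | x ∈ (u : Clopens X)} = k} =
      μ {x | {u : C | x ∈ (f u : Clopens X)} = k} := by
  classical
  have := Fintype.ofFinite C
  let e : C := Finset.univ.inf fun u : C => if u ∈ k then u else uᶜ
  have hmem : ∀ (E : BooleanSubalgebra (Clopens X)) (s : Finset C) (g : C → E) (x : X),
      x ∈ ((s.inf g : E) : Clopens X) ↔ ∀ u ∈ s, x ∈ (g u : Clopens X) := by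
    intro E s g x
    induction s using Finset.induction_on with
    | empty =>
      simp only [Finset.inf_empty, Finset.notMem_empty, false_imp_iff, implies_true, iff_true]
      exact Set.mem_univ x
    | insert a s ha ih =>
      rw [Finset.inf_insert, Finset.forall_mem_insert, ← ih]
      exact Iff.rfl
  have h1 : {x | {u : C | x ∈ (u : Clopens X)} = k} = ((e : Clopens X) : Set X) := by
    ext x
    change _ ↔ x ∈ (e : Clopens X)
    rw [hmem, Set.mem_ofPred_eq, Set.ext_iff]
    refine ⟨fun h u _ => ?_, fun h u => ?_⟩
    · have := h u
      by_cases hu : u ∈ k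
      · simpa [hu] using this
      · simp only [hu, if_false, iff_false] at this ⊢
        exact this
    · have := h u (Finset.mem_univ u)
      by_cases hu : u ∈ k
      · simpa [hu] using this
      · simp only [hu, if_false, iff_false] at this ⊢
        exact this
  have h2 : {x | {u : C | x ∈ (f u : Clopens X)} = k} = ((f e : Clopens X) : Set X) := by
    have hfe : f e = Finset.univ.inf fun u : C => if u ∈ k then f u else (f u)ᶜ := by
      rw [map_finset_inf]
      congr 1
      ext1 u
      by_cases hu : u ∈ k <;> simp [hu]
    ext x
    change _ ↔ x ∈ (f e : Clopens X)
    rw [hfe, hmem, Set.mem_ofPred_eq, Set.ext_iff]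
    refine ⟨fun h u _ => ?_, fun h u => ?_⟩
    · have := h u
      by_cases hu : u ∈ k
      · simpa [hu] using this
      · simp only [hu, if_false, iff_false] at this ⊢
        exact this
    · have := h u (Finset.mem_univ u)
      by_cases hu : u ∈ k
      · simpa [hu] using this
      · simp only [hu, if_false, iff_false] at this ⊢
        exact this
  rw [h1, h2, hf]

lemma IsGoodMeasure.partialAutomorphismsExtend [BorelSpace X] {μ : Measure X}
    (hμ : IsGoodMeasure μ) : PartialAutomorphismsExtend μ := by
  classical
  intro A C D hAfin hC hD f hf
  have := hμ.isProbability
  have : Finite A := hAfin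
  have : Finite C := Finite.of_injective (fun c : C => (⟨c, hC c.2⟩ : A))
    fun c c' h => Subtype.ext (congrArg (fun z : A => (z : Clopens X)) h)
  -- The pieces of the initial partition are the atoms of `A`, and a piece is labelled by the set
  -- of members `u` of `C` which contain it, respectively whose image `f u` contains it.
  let a : X → Set A := fun x => {u | x ∈ (u : Clopens X)}
  have ha : ∀ s, IsClopen (a ⁻¹' {s}) := fun s => by
    have : a ⁻¹' {s} = ⋂ u : A, if u ∈ s then ((u : Clopens X) : Set X) else
        (((u : Clopens X)ᶜ : Clopens X) : Set X) := by
      ext x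
      simp only [Set.mem_preimage, Set.mem_singleton_iff, Set.mem_iInter, Set.ext_iff]
      refine forall_congr' fun u => ?_
      by_cases hu : u ∈ s
      · simp [hu, a]
      · simp [hu, a]
    rw [this]
    refine isClopen_iInter_of_finite fun u => ?_
    split_ifs
    exacts [Clopens.isClopen _, Clopens.isClopen _]
  obtain ⟨I, _, p, q, σ, hp, hpc, hqp, hσ, hσμ⟩ := hμ.exists_refinement_perm ha
    (fun s => {u : C | (⟨u, hC u.2⟩ : A) ∈ s}) (fun s => {u : C | (⟨f u, hD (f u).2⟩ : A) ∈ s})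
    (fun k => by
      have := hf.measure_setOf_eq k
      simpa [Measure.real, a] using congrArg ENNReal.toReal this)
  have := Fintype.ofFinite I
  let Φ := fiberAlgebraIso hp hpc
  have hval : ∀ S, ((Φ S : Clopens X) : Set X) = p ⁻¹' S := fun S => rfl
  have hA : ∀ v : A, ((v : Clopens X) : Set X) = p ⁻¹' {i | v ∈ q i} := fun v => by
    ext x
    simp [hqp, a]
  let g : fiberAlgebra p ≃o fiberAlgebra p := (Φ.symm.trans σ.toOrderIsoSet).trans Φ
  have hg : ∀ S, g (Φ S) = Φ (σ '' S) := fun S => by simp [g]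
  refine ⟨fiberAlgebra p, fun v hv => ⟨_, hA ⟨v, hv⟩⟩, g, ?_, fun b => ?_, fun c => ?_⟩
  · exact Finite.of_equiv _ Φ.toEquiv
  · obtain ⟨S, rfl⟩ := Φ.surjective b
    rw [hg, hval, hval, ← ENNReal.toReal_eq_toReal_iff' (measure_ne_top _ _) (measure_ne_top _ _)]
    change μ.real _ = μ.real _
    rw [measureReal_preimage_eq_sum hpc, measureReal_preimage_eq_sum hpc, ← Equiv.sum_comp σ]
    simp [hσμ]
  · set S : Set I := {i | (⟨c, hC c.2⟩ : A) ∈ q i} with hS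
    have h1 : (⟨c, ⟨S, hA ⟨c, hC c.2⟩⟩⟩ : fiberAlgebra p) = Φ S :=
      Subtype.ext (Clopens.ext (hA ⟨c, hC c.2⟩))
    apply Clopens.ext
    rw [h1, hg, hval, show ((f c : Clopens X) : Set X) = _ from hA ⟨f c, hD (f c).2⟩]
    congr 1
    ext i
    obtain ⟨j, rfl⟩ := σ.surjective i
    have := Set.ext_iff.1 (hσ j) c
    simp only [Set.mem_ofPred_eq] at this
    simp [hS, this]

end


section

variable {X : Type u} [TopologicalSpace X]

/-! ### Equivalence of sets along orbits -/

/-- `A` and `B` are orbit equivalent under `φ`: a bijection from `A` to `B`, continuous on `A`, maps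
every point of `A` into its own `φ`-orbit. The bijection is a total function, with irrelevant
values off `A`. -/
def OrbitEquiv (φ : X ≃ₜ X) (A B : Set X) : Prop :=
  ∃ g : X → X, ContinuousOn g A ∧ Set.BijOn g A B ∧ ∀ x ∈ A, ∃ n : ℤ, g x = (φ ^ n) x

lemma continuousOn_invFunOn [CompactSpace X] [T2Space X] [Nonempty X] {g : X → X} {A B : Set X}
    (hA : IsClosed A) (hg : ContinuousOn g A) (hb : Set.BijOn g A B) :
    ContinuousOn (Function.invFunOn g A) B := by
  rw [continuousOn_iff_isClosed]
  intro K hK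
  refine ⟨g '' (K ∩ A), ((hK.inter hA).isCompact.image_of_continuousOn
    (hg.mono Set.inter_subset_right)).isClosed, ?_⟩
  have hinv := hb.invOn_invFunOn
  ext y
  constructor
  · rintro ⟨hy, hyB⟩
    exact ⟨⟨_, ⟨hy, hb.surjOn.mapsTo_invFunOn hyB⟩, hinv.2 hyB⟩, hyB⟩
  · rintro ⟨⟨x, ⟨hxK, hxA⟩, rfl⟩, hyB⟩
    refine ⟨?_, hyB⟩
    rw [Set.mem_preimage, hinv.1 hxA]
    exact hxK

lemma exists_zpow_invFunOn [Nonempty X] {φ : X ≃ₜ X} {g : X → X} {A B : Set X}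
    (hb : Set.BijOn g A B) (ho : ∀ x ∈ A, ∃ n : ℤ, g x = (φ ^ n) x) (y : X) (hy : y ∈ B) :
    ∃ n : ℤ, Function.invFunOn g A y = (φ ^ n) y := by
  obtain ⟨n, hn⟩ := ho _ (hb.surjOn.mapsTo_invFunOn hy)
  rw [hb.invOn_invFunOn.2 hy] at hn
  refine ⟨-n, ?_⟩
  nth_rewrite 2 [hn]
  rw [← Homeomorph.mul_apply, ← zpow_add, neg_add_cancel, zpow_zero, Homeomorph.one_apply]

lemma OrbitEquiv.symm [CompactSpace X] [T2Space X] {φ : X ≃ₜ X} {A B : Set X} (hA : IsClosed A)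
    (h : OrbitEquiv φ A B) : OrbitEquiv φ B A := by
  rcases isEmpty_or_nonempty X with hX | hX
  · exact ⟨id, continuousOn_id, by
      rw [Set.eq_empty_of_isEmpty A, Set.eq_empty_of_isEmpty B]; exact Set.bijOn_empty _,
      fun x => hX.elim x⟩
  obtain ⟨g, hg, hb, ho⟩ := h
  exact ⟨Function.invFunOn g A, continuousOn_invFunOn hA hg hb, hb.symm hb.invOn_invFunOn.symm,
    exists_zpow_invFunOn hb ho⟩

lemma OrbitEquiv.union {φ : X ≃ₜ X} {A A' B B' : Set X} (hA : IsOpen A) (hA' : IsOpen A')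
    (hAA' : Disjoint A A') (hBB' : Disjoint B B') (h : OrbitEquiv φ A B) (h' : OrbitEquiv φ A' B') :
    OrbitEquiv φ (A ∪ A') (B ∪ B') := by
  classical
  obtain ⟨g, hg, hb, ho⟩ := h
  obtain ⟨g', hg', hb', ho'⟩ := h'
  have e : Set.EqOn (A.piecewise g g') g A := A.piecewise_eqOn g g'
  have e' : Set.EqOn (A.piecewise g g') g' A' := fun x hx =>
    Set.piecewise_eq_of_notMem _ _ _ (Set.disjoint_right.1 hAA' hx)
  refine ⟨A.piecewise g g', (hg.congr e).union_of_isOpen (hg'.congr e') hA hA', ?_, ?_⟩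
  · have b := hb.congr e.symm
    have b' := hb'.congr e'.symm
    refine b.union b' ?_
    rw [Set.injOn_union hAA']
    exact ⟨b.injOn, b'.injOn, fun x hx y hy hxy =>
      Set.disjoint_left.1 hBB' (b.mapsTo hx) (hxy ▸ b'.mapsTo hy)⟩
  · rintro x (hx | hx)
    · rw [e hx]; exact ho x hx
    · rw [e' hx]; exact ho' x hx

/-! ### Invariant measures -/

variable [MeasurableSpace X] [BorelSpace X]

lemma measurePreserving_zpow {φ : X ≃ₜ X} {μ : Measure X} (hφ : MeasurePreserving φ μ μ) (n : ℤ) :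
    MeasurePreserving (φ ^ n : X ≃ₜ X) μ μ := by
  have hnat : ∀ n : ℕ, MeasurePreserving (φ ^ n : X ≃ₜ X) μ μ := by
    intro n
    induction n with
    | zero => exact MeasurePreserving.id μ
    | succ n ih => rw [pow_succ]; exact ih.comp hφ
  cases n with
  | ofNat n => simpa using hnat n
  | negSucc n =>
    rw [zpow_negSucc]
    exact MeasurePreserving.symm (φ ^ (n + 1) : X ≃ₜ X).toMeasurableEquiv (hnat _)

lemma measure_zpow_image {φ : X ≃ₜ X} {μ : Measure X} (hφ : MeasurePreserving φ μ μ) (n : ℤ)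
    (S : Set X) : μ ((φ ^ n : X ≃ₜ X) '' S) = μ S := by
  have h := (measurePreserving_zpow hφ n).measure_preimage_emb
    (φ ^ n : X ≃ₜ X).measurableEmbedding ((φ ^ n : X ≃ₜ X) '' S)
  rwa [Set.preimage_image_eq _ (φ ^ n : X ≃ₜ X).injective, eq_comm] at h

/-- An orbit equivalence moves countably many measurable pieces by powers of `φ`. -/
lemma OrbitEquiv.measure_le [T2Space X] {φ : X ≃ₜ X} {μ : Measure X}
    (hφ : MeasurePreserving φ μ μ) {A B : Set X} (hA : IsClosed A) (h : OrbitEquiv φ A B) :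
    μ B ≤ μ A := by
  obtain ⟨g, hg, hb, ho⟩ := h
  let e : ℕ ≃ ℤ := (Denumerable.eqv ℤ).symm
  let E : ℕ → Set X := fun n => {x ∈ A | g x = (φ ^ e n) x}
  have hE : ∀ n, MeasurableSet (E n) := fun n => IsClosed.measurableSet <| by
    have hc : ContinuousOn (fun x => (g x, (φ ^ e n) x)) A :=
      hg.prodMk (φ ^ e n : X ≃ₜ X).continuous.continuousOn
    exact hc.preimage_isClosed_of_isClosed hA isClosed_diagonal
  have hsub : B ⊆ ⋃ n, (φ ^ e n : X ≃ₜ X) '' disjointed E n := by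
    intro y hy
    obtain ⟨x, hx, rfl⟩ := hb.surjOn hy
    obtain ⟨n, hn⟩ := ho x hx
    have hxE : x ∈ ⋃ n, disjointed E n := by
      rw [iUnion_disjointed]
      exact Set.mem_iUnion.2 ⟨e.symm n, hx, by simpa using hn⟩
    obtain ⟨m, hm⟩ := Set.mem_iUnion.1 hxE
    exact Set.mem_iUnion.2 ⟨m, x, hm, ((disjointed_subset E m) hm).2.symm⟩
  calc μ B ≤ ∑' n, μ ((φ ^ e n : X ≃ₜ X) '' disjointed E n) :=
        (measure_mono hsub).trans (measure_iUnion_le _)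
    _ = ∑' n, μ (disjointed E n) := by simp only [measure_zpow_image hφ]
    _ = μ (⋃ n, disjointed E n) := (measure_iUnion (disjoint_disjointed E)
        fun n => MeasurableSet.disjointed hE n).symm
    _ ≤ μ A := measure_mono (by
        rw [iUnion_disjointed]
        exact Set.iUnion_subset fun n x hx => hx.1)

lemma OrbitEquiv.measure_eq [CompactSpace X] [T2Space X] {φ : X ≃ₜ X} {μ : Measure X}
    (hφ : MeasurePreserving φ μ μ) {A B : Set X} (hA : IsClosed A) (hB : IsClosed B)
    (h : OrbitEquiv φ A B) : μ A = μ B :=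
  le_antisymm ((h.symm hA).measure_le hφ hB) (h.measure_le hφ hA)

end


section

variable {X : Type u} [TopologicalSpace X] [MeasurableSpace X] [BorelSpace X]

/-! ### Uniform positivity of Birkhoff sums -/

open Filter Topology CompactlySupported in
/-- If `μ` is the only invariant probability measure of `φ` and `∫ F ∂μ > 0`, some Birkhoff sum of
`F` is positive everywhere. Otherwise a limit, along an ultrafilter, of Birkhoff averages at points
where the sums are nonpositive is an invariant mean, whose representing measure is invariant and
gives `F` a nonpositive integral. -/
lemma exists_birkhoffSum_pos [CompactSpace X] [MetrizableSpace X] {φ : X ≃ₜ X}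
    {μ : Measure X} (huniq : ∀ ν : Measure X, IsProbabilityMeasure ν ∧ MeasurePreserving φ ν ν →
      ν = μ) {F : X → ℝ} (hF : Continuous F) (hpos : 0 < ∫ x, F x ∂μ) :
    ∃ N, ∀ x, 0 < birkhoffSum φ F N x := by
  by_contra! hcon
  choose z hz using hcon
  let avg (h : X → ℝ) (n : ℕ) : ℝ := birkhoffAverage ℝ φ h (n + 1) (z (n + 1))
  let U : Ultrafilter ℕ := hyperfilter ℕ
  have hn0 : ∀ n : ℕ, (0 : ℝ) < ((n + 1 : ℕ) : ℝ) := fun n => by positivity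
  have havg : ∀ h n, avg h n = ((n + 1 : ℕ) : ℝ)⁻¹ * birkhoffSum φ h (n + 1) (z (n + 1)) :=
    fun h n => rfl
  have hbound : ∀ h : X → ℝ, Continuous h → ∃ C, ∀ x, |h x| ≤ C := fun h hh => by
    obtain ⟨C, hC⟩ := isCompact_univ.exists_bound_of_continuousOn hh.continuousOn
    exact ⟨C, fun x => hC x trivial⟩
  have hsum : ∀ (h : X → ℝ) (C : ℝ), (∀ x, |h x| ≤ C) → ∀ n x, |birkhoffSum φ h n x| ≤ n * C := by
    intro h C hC n x
    refine (Finset.abs_sum_le_sum_abs _ _).trans ?_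
    refine (Finset.sum_le_card_nsmul _ _ C fun k _ => hC _).trans ?_
    simp
  have hlim : ∀ h : C_c(X, ℝ), ∃ l : ℝ, Tendsto (avg h) U (𝓝 l) := by
    intro h
    obtain ⟨C, hC⟩ := hbound h h.continuous
    have hmem : ∀ n, avg h n ∈ Set.Icc (-C) C := fun n => by
      rw [Set.mem_Icc, ← abs_le, havg, abs_mul, abs_inv, abs_of_pos (hn0 n),
        inv_mul_le_iff₀ (hn0 n)]
      exact hsum h C hC _ _
    obtain ⟨l, -, hl⟩ := (isCompact_Icc (a := -C) (b := C)).ultrafilter_le_nhds (U.map (avg h))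
      (by rw [le_principal_iff]; exact Filter.mem_map.2 (Filter.Eventually.of_forall hmem))
    exact ⟨l, hl⟩
  choose L hL using hlim
  have hbs : ∀ (h k : X → ℝ) n x, birkhoffSum φ (fun x => h x + k x) n x =
      birkhoffSum φ h n x + birkhoffSum φ k n x := fun h k n x => by
    simp [birkhoffSum, Finset.sum_add_distrib]
  let Λ : C_c(X, ℝ) →ₚ[ℝ] ℝ := PositiveLinearMap.mk₀
    { toFun := L
      map_add' := fun h k => by
        refine tendsto_nhds_unique (hL (h + k)) (((hL h).add (hL k)).congr fun n => ?_)
        rw [havg, havg, havg, ← mul_add, ← hbs]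
        rfl
      map_smul' := fun c h => by
        refine tendsto_nhds_unique (hL (c • h)) (((hL h).const_mul c).congr fun n => ?_)
        rw [havg, havg, mul_left_comm]
        congr 1
        simp [birkhoffSum, Finset.mul_sum] }
    (fun h hh => ge_of_tendsto' (hL h) fun n => by
      rw [havg]
      exact mul_nonneg (inv_nonneg.2 (hn0 n).le) (Finset.sum_nonneg fun k _ => hh _))
  set ν := RealRMK.rieszMeasure Λ
  have hint : ∀ h : C_c(X, ℝ), ∫ x, h x ∂ν = L h := fun h => RealRMK.integral_rieszMeasure Λ h
  let cc (h : C(X, ℝ)) : C_c(X, ℝ) := CompactlySupportedContinuousMap.continuousMapEquiv h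
  have hcc : ∀ h x, cc h x = h x := fun h x => rfl
  have hfin : IsFiniteMeasure ν := ⟨isCompact_univ.measure_lt_top⟩
  have hprob : IsProbabilityMeasure ν := by
    have h1 := hint (cc 1)
    have h2 : L (cc 1) = 1 := by
      refine tendsto_nhds_unique (hL (cc 1)) (tendsto_const_nhds.congr fun n => ?_)
      rw [havg]
      simp only [birkhoffSum, hcc, ContinuousMap.one_apply, Finset.sum_const, Finset.card_range,
        nsmul_eq_mul, mul_one]
      exact (inv_mul_cancel₀ (hn0 n).ne').symm
    rw [h2] at h1
    simp only [hcc, ContinuousMap.one_apply, integral_const, smul_eq_mul, mul_one] at h1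
    exact (isProbabilityMeasure_iff_real).2 h1
  have hinv : MeasurePreserving φ ν ν := by
    refine ⟨φ.continuous.measurable, ?_⟩
    have : IsFiniteMeasure (ν.map φ) := Measure.isFiniteMeasure_map ν φ
    refine ext_of_forall_integral_eq_of_IsFiniteMeasure fun h => ?_
    rw [integral_map φ.continuous.measurable.aemeasurable
      h.continuous.aestronglyMeasurable]
    let h₀ : C(X, ℝ) := h.toContinuousMap
    let h₁ : C(X, ℝ) := h₀.comp ⟨φ, φ.continuous⟩
    have e0 : ∫ x, h x ∂ν = L (cc h₀) := hint (cc h₀)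
    have e1 : ∫ x, h (φ x) ∂ν = L (cc h₁) := hint (cc h₁)
    rw [e0, e1]
    obtain ⟨C, hC⟩ := hbound h h.continuous
    -- The Birkhoff sum of `h ∘ φ - h` telescopes to two terms.
    have hdiff : ∀ n, avg (cc h₁) n - avg (cc h₀) n =
        ((n + 1 : ℕ) : ℝ)⁻¹ * (h (φ^[n + 1] (z (n + 1))) - h (z (n + 1))) := fun n => by
      rw [havg, havg, ← mul_sub]
      congr 1
      have := birkhoffSum_apply_sub_birkhoffSum φ (cc h₀) (n + 1) (z (n + 1))
      refine Eq.trans ?_ this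
      congr 1
      simp only [birkhoffSum, ← Function.iterate_succ_apply, Function.iterate_succ_apply']
      rfl
    have ht : Tendsto (fun n => avg (cc h₁) n - avg (cc h₀) n) atTop (𝓝 0) := by
      simp only [hdiff]
      refine squeeze_zero_norm (a := fun n : ℕ => ((n + 1 : ℕ) : ℝ)⁻¹ * (2 * C)) (fun n => ?_) ?_
      · rw [norm_mul, Real.norm_of_nonneg (inv_nonneg.2 (hn0 n).le)]
        refine mul_le_mul_of_nonneg_left ?_ (inv_nonneg.2 (hn0 n).le)
        refine (norm_sub_le _ _).trans ?_
        have := hC (φ^[n + 1] (z (n + 1)))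
        have := hC (z (n + 1))
        simp only [Real.norm_eq_abs]
        linarith
      · have := (tendsto_inv_atTop_zero.comp
          (tendsto_natCast_atTop_atTop.comp (tendsto_add_atTop_nat 1))).mul_const (2 * C)
        simpa using this
    have hU : (U : Filter ℕ) ≤ atTop := Nat.hyperfilter_le_atTop
    exact sub_eq_zero.1 (tendsto_nhds_unique ((hL _).sub (hL _)) (ht.mono_left hU))
  rw [← huniq ν ⟨hprob, hinv⟩] at hpos
  have hF' : ∫ x, F x ∂ν = L (cc ⟨F, hF⟩) := hint (cc ⟨F, hF⟩)
  rw [hF'] at hpos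
  refine hpos.not_ge (le_of_tendsto' (hL _) fun n => ?_)
  rw [havg]
  exact mul_nonpos_of_nonneg_of_nonpos (inv_nonneg.2 (hn0 n).le) (hz _)

end


lemma pow_apply_eq_iterate {X : Type u} [TopologicalSpace X] (φ : X ≃ₜ X) (n : ℕ) (x : X) :
    (φ ^ n) x = φ^[n] x := by
  induction n generalizing x with
  | zero => rfl
  | succ n ih => rw [pow_succ, Homeomorph.mul_apply, ih, Function.iterate_succ_apply]

section

variable {X : Type u} [TopologicalSpace X] [MeasurableSpace X] [BorelSpace X]

/-! ### Comparison of clopen sets -/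

/-- **Comparison.** If `μ A < μ B`, the clopen set `A` is orbit equivalent to a clopen
subset of `B`.

Read along an orbit, `A` is matched into `B` like opening and closing brackets: with
`f = 1_B - 1_A`, a point `x` of `A` is sent to `φ^n x` for the first `n` at which the Birkhoff sum
of `f` over `x, …, φ^n x` is nonnegative. Such an `n` exists because some Birkhoff sum of `f` is
positive everywhere. -/
lemma exists_orbitEquiv_subset [CompactSpace X] [MetrizableSpace X] {φ : X ≃ₜ X}
    {μ : Measure X} [IsProbabilityMeasure μ] (huniq : ∀ ν : Measure X, IsProbabilityMeasure ν ∧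
      MeasurePreserving φ ν ν → ν = μ) {A B : Set X} (hA : IsClopen A) (hB : IsClopen B)
    (hAB : μ A < μ B) : ∃ C, IsClopen C ∧ C ⊆ B ∧ OrbitEquiv φ A C := by
  classical
  let f : X → ℤ := LocallyConstant.charFn ℤ hB - LocallyConstant.charFn ℤ hA
  have hfc : Continuous f := (LocallyConstant.charFn ℤ hB - LocallyConstant.charFn ℤ hA).continuous
  have hf : ∀ x, f x = (if x ∈ B then 1 else 0) - if x ∈ A then 1 else 0 := fun x => by
    simp [f, LocallyConstant.coe_charFn, Set.indicator_apply]
  have hfA : ∀ x ∈ A, f x ≤ 0 := fun x hx => by rw [hf]; split_ifs <;> simp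
  have hf1 : ∀ x, f x ≤ 1 := fun x => by rw [hf]; split_ifs <;> simp
  have hfB : ∀ x, 0 < f x → x ∈ B := fun x hx => by
    by_contra h
    rw [hf, if_neg h] at hx
    split_ifs at hx <;> omega
  let S (n : ℕ) (x : X) : ℤ := birkhoffSum φ f n x
  have hSc : ∀ n, Continuous (S n) := fun n => continuous_finsetSum _ fun k _ =>
    hfc.comp (φ.continuous.iterate k)
  have hS1 : ∀ x, S 1 x = f x := fun x => birkhoffSum_one _ _ x
  have hSsucc : ∀ n x, S (n + 1) x = S n x + f (φ^[n] x) := fun n x => birkhoffSum_succ _ _ n x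
  have hSadd : ∀ m n x, S (m + n) x = S m x + S n (φ^[m] x) := fun m n x =>
    birkhoffSum_add _ _ m n x
  -- Birkhoff sums of `f` become positive.
  obtain ⟨N, hN⟩ : ∃ N, ∀ x, 0 < S N x := by
    obtain ⟨N, hN⟩ := exists_birkhoffSum_pos huniq (F := fun x => (f x : ℝ))
      (continuous_of_discreteTopology.comp hfc) (by
        have h1 : (fun x => (f x : ℝ)) =
            fun x => B.indicator (fun _ => (1 : ℝ)) x - A.indicator (fun _ => (1 : ℝ)) x := by
          ext x
          rw [hf]
          simp [Set.indicator_apply]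
        rw [h1, integral_sub
          ((integrable_const _).indicator hB.isOpen.measurableSet)
          ((integrable_const _).indicator hA.isOpen.measurableSet),
          integral_indicator_const _ hB.isOpen.measurableSet,
          integral_indicator_const _ hA.isOpen.measurableSet]
        simpa [Measure.real] using (ENNReal.toReal_lt_toReal (measure_ne_top _ _)
          (measure_ne_top _ _)).2 hAB)
    refine ⟨N, fun x => ?_⟩
    have h := hN x
    have h2 : birkhoffSum φ (fun x => (f x : ℝ)) N x = ((S N x : ℤ) : ℝ) := by
      simp [S, birkhoffSum]
    rw [h2] at h
    exact_mod_cast h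
  have hex : ∀ x, ∃ n, 0 ≤ S (n + 1) x := fun x => by
    cases N with
    | zero => exact absurd (hN x) (by simp [S])
    | succ n => exact ⟨n, (hN x).le⟩
  let t (x : X) : ℕ := Nat.find (hex x)
  have ht : ∀ x, 0 ≤ S (t x + 1) x := fun x => Nat.find_spec (hex x)
  have htmin : ∀ x m, m < t x → S (m + 1) x < 0 := fun x m hm => not_le.1 (Nat.find_min (hex x) hm)
  -- As `f ≤ 1` and the sums before time `t x` are negative, the first nonnegative sum vanishes, and
  -- if `t x > 0`, its last term is `1`.
  have ht0 : ∀ x ∈ A, S (t x + 1) x = 0 ∧ φ^[t x] x ∈ B := by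
    intro x hx
    have h0 := ht x
    rcases Nat.eq_zero_or_pos (t x) with h | h
    · rw [h, hS1] at h0
      have h1 : f x = 0 := le_antisymm (hfA x hx) h0
      refine ⟨by rw [h, hS1, h1], ?_⟩
      rw [h]
      by_contra hxB
      rw [hf] at h1
      simp only [Function.iterate_zero, id_eq] at hxB
      simp [hx, hxB] at h1
    · have h1 := htmin x (t x - 1) (by omega)
      rw [Nat.sub_add_cancel h] at h1
      have h2 := hSsucc (t x) x
      have h3 := hf1 (φ^[t x] x)
      exact ⟨by omega, hfB _ (by omega)⟩
  let g (x : X) : X := φ^[t x] x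
  let T (n : ℕ) : Set X := A ∩ {x | t x = n}
  have hT : ∀ n, IsOpen (T n) := by
    intro n
    have hc : ∀ m (s : Set ℤ), IsOpen (S m ⁻¹' s) := fun m s =>
      (isOpen_discrete s).preimage (hSc m)
    have h1 : T n = A ∩ (S (n + 1) ⁻¹' {z | 0 ≤ z} ∩
        ⋂ m ∈ Set.Iio n, S (m + 1) ⁻¹' {z | z < 0}) := by
      ext x
      simp only [T, t, Set.mem_inter_iff, Set.mem_ofPred_eq, Nat.find_eq_iff, Set.mem_preimage,
        Set.mem_iInter, Set.mem_Iio, not_le]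
    rw [h1]
    exact hA.isOpen.inter ((hc _ _).inter ((Set.finite_Iio n).isOpen_biInter fun m _ => hc _ _))
  have hgc : ContinuousOn g A := by
    intro x hx
    refine ContinuousAt.continuousWithinAt ?_
    refine (φ.continuous.iterate (t x)).continuousAt.congr ?_
    filter_upwards [(hT (t x)).mem_nhds ⟨hx, rfl⟩] with y hy
    simp only [g]
    rw [hy.2]
  -- If `y = φ^k x`, `k > 0`, had the same partner as `x`, the Birkhoff sum over `x, …, φ^(k-1) x`
  -- would vanish before time `t x`.
  have hinj : ∀ x ∈ A, ∀ y ∈ A, t y ≤ t x → g x = g y → x = y := by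
    intro x hx y hy hle hxy
    have hit : ∀ k, Function.Injective (φ^[k]) := fun k => φ.injective.iterate k
    have h1 : φ^[t x - t y] x = y := by
      apply hit (t y)
      rw [← Function.iterate_add_apply, Nat.add_sub_cancel' hle]
      exact hxy
    rcases Nat.eq_zero_or_pos (t x - t y) with h | h
    · rw [h] at h1; exact h1
    · exfalso
      have h2 := hSadd (t x - t y) (t y + 1) x
      rw [h1, (ht0 y hy).1, show t x - t y + (t y + 1) = t x + 1 by omega, (ht0 x hx).1] at h2
      have h3 := htmin x (t x - t y - 1) (by omega)
      rw [Nat.sub_add_cancel h] at h3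
      omega
  refine ⟨g '' A, ⟨(hA.isClosed.isCompact.image_of_continuousOn hgc).isClosed, ?_⟩, ?_, g, hgc,
    Set.InjOn.bijOn_image fun x hx y hy hxy => ?_, fun x _ => ⟨t x, ?_⟩⟩
  · have h1 : g '' A = ⋃ n, (φ ^ n : X ≃ₜ X) '' T n := by
      ext z
      simp only [Set.mem_image, Set.mem_iUnion]
      constructor
      · rintro ⟨x, hx, rfl⟩
        exact ⟨t x, x, ⟨hx, rfl⟩, by rw [pow_apply_eq_iterate]⟩
      · rintro ⟨n, x, ⟨hx, rfl⟩, rfl⟩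
        exact ⟨x, hx, by rw [pow_apply_eq_iterate]⟩
    rw [h1]
    exact isOpen_iUnion fun n => (φ ^ n : X ≃ₜ X).isOpenMap _ (hT n)
  · rintro _ ⟨x, hx, rfl⟩
    exact (ht0 x hx).2
  · rcases le_total (t y) (t x) with h | h
    · exact hinj x hx y hy h hxy
    · exact (hinj y hy x hx h hxy.symm).symm
  · rw [zpow_natCast, pow_apply_eq_iterate]

/-! ### Clopen sets of equal measure are orbit equivalent -/

/-- Gluing countably many orbit equivalences between the successive differences of two decreasing
sequences of clopen sets which shrink to points of the same orbit. -/
lemma orbitEquiv_of_antitone {X : Type u} [TopologicalSpace X] {φ : X ≃ₜ X} {A B : ℕ → Set X}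
    {x₀ y₀ : X} (hA : ∀ n, IsClopen (A n)) (hAanti : Antitone A) (hBanti : Antitone B)
    (hx : ⋂ n, A n = {x₀}) (hy : ⋂ n, B n = {y₀}) (hyb : ∀ V ∈ nhds y₀, ∃ n, B n ⊆ V)
    (ho : ∃ k : ℤ, y₀ = (φ ^ k) x₀) (h : ∀ n, OrbitEquiv φ (A n \ A (n + 1)) (B n \ B (n + 1))) :
    OrbitEquiv φ (A 0) (B 0) := by
  classical
  choose g hgc hgb hgo using h
  have hx₀ : ∀ n, x₀ ∈ A n := Set.mem_iInter.1 (hx ▸ rfl)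
  have hy₀ : ∀ n, y₀ ∈ B n := Set.mem_iInter.1 (hy ▸ rfl)
  have level : ∀ (C : ℕ → Set X) (c : X), ⋂ n, C n = {c} → ∀ x ∈ C 0, x ≠ c →
      ∃ n, x ∈ C n \ C (n + 1) := by
    intro C c hC x hx0 hxc
    have h1 : ∃ n, x ∉ C n := by
      by_contra! hcon
      exact hxc (by have := Set.mem_iInter.2 hcon; rwa [hC] at this)
    have h2 := Nat.find_spec h1
    have h3 : Nat.find h1 ≠ 0 := fun h0 => by rw [h0] at h2; exact h2 hx0
    obtain ⟨n, hn⟩ := Nat.exists_eq_succ_of_ne_zero h3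
    refine ⟨n, not_not.1 (Nat.find_min h1 (by omega)), ?_⟩
    rwa [hn] at h2
  have level_le : ∀ (C : ℕ → Set X), Antitone C → ∀ x n m, x ∈ C n \ C (n + 1) →
      (x ∈ C m ↔ m ≤ n) := by
    intro C hC x n m hxn
    refine ⟨fun hxm => ?_, fun hmn => hC hmn hxn.1⟩
    by_contra! hlt
    exact hxn.2 (hC hlt hxm)
  have level_unique : ∀ (C : ℕ → Set X), Antitone C → ∀ x n m, x ∈ C n \ C (n + 1) →
      x ∈ C m \ C (m + 1) → n = m := fun C hC x n m hn hm =>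
    le_antisymm ((level_le C hC x m n hm).1 hn.1) ((level_le C hC x n m hn).1 hm.1)
  -- `G` is `g n` on `A n \ A (n + 1)`, and sends `x₀`, which lies in no such difference, to `y₀`.
  let G : X → X := fun x => if h : ∃ n, x ∈ A n \ A (n + 1) then g h.choose x else y₀
  have hG : ∀ n, Set.EqOn G (g n) (A n \ A (n + 1)) := by
    intro n x hxn
    have hex : ∃ n, x ∈ A n \ A (n + 1) := ⟨n, hxn⟩
    simp only [G, dif_pos hex]
    rw [level_unique A hAanti x _ n hex.choose_spec hxn]
  have hG₀ : G x₀ = y₀ := by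
    have hex : ¬ ∃ n, x₀ ∈ A n \ A (n + 1) := fun ⟨n, hn⟩ => hn.2 (hx₀ _)
    simp only [G, dif_neg hex]
  have hGm : ∀ n, ∀ x ∈ A n \ A (n + 1), G x ∈ B n \ B (n + 1) := fun n x hxn =>
    hG n hxn ▸ (hgb n).mapsTo hxn
  have hGB : ∀ n, ∀ x ∈ A n, G x ∈ B n := by
    intro n x hxn
    by_cases hxx : x = x₀
    · subst hxx; rw [hG₀]; exact hy₀ n
    · obtain ⟨m, hm⟩ := level A x₀ hx x (hAanti (Nat.zero_le n) hxn) hxx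
      exact hBanti ((level_le A hAanti x m n hm).1 hxn) (hGm m x hm).1
  refine ⟨G, fun x hxA => ContinuousAt.continuousWithinAt ?_, ⟨hGB 0, ?_, ?_⟩, ?_⟩
  · by_cases hxx : x = x₀
    · subst hxx
      intro V hV
      rw [hG₀] at hV
      rw [Filter.mem_map]
      obtain ⟨n, hn⟩ := hyb V hV
      filter_upwards [(hA n).isOpen.mem_nhds (hx₀ n)] with z hz using hn (hGB n z hz)
    · obtain ⟨m, hm⟩ := level A x₀ hx x hxA hxx
      have hnhds := ((hA m).diff (hA (m + 1))).isOpen.mem_nhds hm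
      refine ((hgc m).continuousAt hnhds).congr ?_
      filter_upwards [hnhds] with z hz using (hG m hz).symm
  · have aux : ∀ z ∈ A 0, z ≠ x₀ → G z ≠ y₀ := fun z hzA hzx hzy => by
      obtain ⟨m, hm⟩ := level A x₀ hx z hzA hzx
      exact (hGm m z hm).2 (hzy ▸ hy₀ _)
    intro x hxA z hzA hxz
    by_cases hxx : x = x₀
    · by_contra hne
      subst hxx
      exact aux z hzA (Ne.symm hne) (by rw [← hxz, hG₀])
    by_cases hzz : z = x₀
    · subst hzz
      exact absurd (by rw [hxz, hG₀]) (aux x hxA hxx)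
    obtain ⟨m, hm⟩ := level A x₀ hx x hxA hxx
    obtain ⟨n, hn⟩ := level A x₀ hx z hzA hzz
    obtain rfl : m = n := level_unique B hBanti (G x) m n (hGm m x hm) (hxz ▸ hGm n z hn)
    rw [hG m hm, hG m hn] at hxz
    exact (hgb m).injOn hm hn hxz
  · intro y hyB
    by_cases hyy : y = y₀
    · exact ⟨x₀, hx₀ 0, by rw [hG₀, hyy]⟩
    · obtain ⟨m, hm⟩ := level B y₀ hy y hyB hyy
      obtain ⟨x, hxm, rfl⟩ := (hgb m).surjOn hm
      exact ⟨x, hAanti (Nat.zero_le m) hxm.1, hG m hxm⟩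
  · intro x hxA
    by_cases hxx : x = x₀
    · subst hxx; rw [hG₀]; exact ho
    · obtain ⟨m, hm⟩ := level A x₀ hx x hxA hxx
      rw [hG m hm]
      exact hgo m x hm

/-- One direction of a back-and-forth step: comparison exhausts `A` up to a small clopen
neighbourhood of `x₀` by a subset of `B` which avoids a smaller neighbourhood of `y₀`. -/
lemma exists_orbitEquiv_diff [CompactSpace X] [MetrizableSpace X]
    (hz : IsTopologicalBasis {s : Set X | IsClopen s}) {φ : X ≃ₜ X} {μ : Measure X}
    (hφ : MeasurePreserving φ μ μ) [IsProbabilityMeasure μ]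
    (huniq : ∀ ν : Measure X, IsProbabilityMeasure ν ∧ MeasurePreserving φ ν ν → ν = μ)
    (hatom : ∀ x, μ {x} = 0) (hsupp : ∀ U : Set X, IsOpen U → U.Nonempty → 0 < μ U)
    {A B O : Set X} (hA : IsClopen A) (hB : IsClopen B) (hAB : μ A = μ B) {x₀ y₀ : X}
    (hx₀ : x₀ ∈ A) (hy₀ : y₀ ∈ B) (hO : O ∈ nhds x₀) :
    ∃ A' B', IsClopen A' ∧ IsClopen B' ∧ A' ⊆ A ∧ B' ⊆ B ∧ x₀ ∈ A' ∧ y₀ ∈ B' ∧ A' ⊆ O ∧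
      μ A' = μ B' ∧ OrbitEquiv φ (A \ A') (B \ B') := by
  obtain ⟨W, hW, hxW, hWA⟩ := hz.mem_nhds_iff.1 (Filter.inter_mem (hA.isOpen.mem_nhds hx₀) hO)
  have hW : IsClopen W := hW
  have hWpos : μ {y₀} < μ W := by rw [hatom]; exact hsupp W hW.isOpen ⟨x₀, hxW⟩
  obtain ⟨V, hyV, hV, hVμ⟩ := Set.exists_isOpen_lt_of_lt {y₀} _ hWpos
  obtain ⟨W', hW', hyW', hWB⟩ := hz.mem_nhds_iff.1
    (Filter.inter_mem (hB.isOpen.mem_nhds hy₀) (hV.mem_nhds (hyV rfl)))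
  have hW' : IsClopen W' := hW'
  have hWW : μ W' < μ W := (measure_mono (hWB.trans Set.inter_subset_right)).trans_lt hVμ
  have hWA' : W ⊆ A := hWA.trans Set.inter_subset_left
  have hWB' : W' ⊆ B := hWB.trans Set.inter_subset_left
  have hlt : μ (A \ W) < μ (B \ W') := by
    rw [measure_sdiff hWA' hW.isOpen.measurableSet.nullMeasurableSet (measure_ne_top _ _),
      measure_sdiff hWB' hW'.isOpen.measurableSet.nullMeasurableSet (measure_ne_top _ _), hAB]
    exact (ENNReal.cancel_of_ne (ENNReal.sub_ne_top (measure_ne_top _ _))).tsub_lt_tsub_left_of_le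
      (hAB ▸ measure_mono hWA') hWW
  obtain ⟨C, hC, hCB, hAC⟩ := exists_orbitEquiv_subset huniq (hA.diff hW) (hB.diff hW') hlt
  have hCB' : C ⊆ B := hCB.trans Set.sdiff_subset
  refine ⟨W, B \ C, hW, hB.diff hC, hWA', Set.sdiff_subset, hxW,
    ⟨hy₀, fun hyC => (hCB hyC).2 hyW'⟩, hWA.trans Set.inter_subset_right, ?_, ?_⟩
  · rw [measure_sdiff hCB' hC.isOpen.measurableSet.nullMeasurableSet (measure_ne_top _ _),
      ← hAC.measure_eq hφ (hA.diff hW).isClosed hC.isClosed,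
      measure_sdiff hWA' hW.isOpen.measurableSet.nullMeasurableSet (measure_ne_top _ _), ← hAB,
      ENNReal.sub_sub_cancel (measure_ne_top _ _) (measure_mono hWA')]
  · rwa [Set.sdiff_sdiff_cancel_left hCB']

/-- For a uniquely ergodic minimal `φ`, clopen sets of equal measure are orbit equivalent.

Comparison needs a strict inequality of measures, so that it cannot treat `A` and `B` at once.
Instead one fixes `x₀` in `A` and `y₀` in `B` in the same orbit, and repeatedly matches all of what
is left of one of the two sets, except a neighbourhood of its point, with a part of the other. In the
limit only `x₀` and `y₀` are left. -/
lemma orbitEquiv_of_measure_eq [CompactSpace X] [MetrizableSpace X]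
    (hz : IsTopologicalBasis {s : Set X | IsClopen s}) {φ : X ≃ₜ X} (hmin : IsMinimalHomeo φ)
    {μ : Measure X} (hφ : MeasurePreserving φ μ μ) [IsProbabilityMeasure μ]
    (huniq : ∀ ν : Measure X, IsProbabilityMeasure ν ∧ MeasurePreserving φ ν ν → ν = μ)
    (hatom : ∀ x, μ {x} = 0) (hsupp : ∀ U : Set X, IsOpen U → U.Nonempty → 0 < μ U)
    {A B : Set X} (hA : IsClopen A) (hB : IsClopen B) (hAB : μ A = μ B) (hne : A.Nonempty) :
    OrbitEquiv φ A B := by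
  obtain ⟨x₀, hx₀⟩ := hne
  have hBne : B.Nonempty := by
    rw [Set.nonempty_iff_ne_empty]
    rintro rfl
    exact (hsupp A hA.isOpen ⟨x₀, hx₀⟩).ne' (by rw [hAB, measure_empty])
  obtain ⟨_, hy₀, k, rfl⟩ := (hmin x₀).inter_open_nonempty B hB.isOpen hBne
  set y₀ := (φ ^ k) x₀
  obtain ⟨U, hU⟩ := (nhds x₀).exists_antitone_basis
  obtain ⟨V, hV⟩ := (nhds y₀).exists_antitone_basis
  let State := {p : Set X × Set X // IsClopen p.1 ∧ IsClopen p.2 ∧ μ p.1 = μ p.2 ∧ x₀ ∈ p.1 ∧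
    y₀ ∈ p.2}
  -- A step from `A` to `B` makes what is left of `A` small, a step back what is left of `B`.
  have step : ∀ (n : ℕ) (p : State), ∃ q : State, q.1.1 ⊆ p.1.1 ∧ q.1.2 ⊆ p.1.2 ∧ q.1.1 ⊆ U n ∧
      q.1.2 ⊆ V n ∧ OrbitEquiv φ (p.1.1 \ q.1.1) (p.1.2 \ q.1.2) := by
    rintro n ⟨⟨A, B⟩, hA, hB, hAB, hx₀, hy₀⟩
    obtain ⟨A₁, B₁, hA₁, hB₁, hAA₁, hBB₁, hx₁, hy₁, hAU, hμ₁, he₁⟩ :=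
      exists_orbitEquiv_diff hz hφ huniq hatom hsupp hA hB hAB hx₀ hy₀ (hU.mem n)
    obtain ⟨B₂, A₂, hB₂, hA₂, hBB₂, hAA₂, hy₂, hx₂, hBV, hμ₂, he₂⟩ :=
      exists_orbitEquiv_diff hz hφ huniq hatom hsupp hB₁ hA₁ hμ₁.symm hy₁ hx₁ (hV.mem n)
    refine ⟨⟨⟨A₂, B₂⟩, hA₂, hB₂, hμ₂.symm, hx₂, hy₂⟩, hAA₂.trans hAA₁, hBB₂.trans hBB₁,
      hAA₂.trans hAU, hBV, ?_⟩
    have := he₁.union (hA.diff hA₁).isOpen (hA₁.diff hA₂).isOpen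
      (Set.disjoint_sdiff_left.mono_right Set.sdiff_subset)
      (Set.disjoint_sdiff_left.mono_right Set.sdiff_subset) (he₂.symm (hB₁.diff hB₂).isClosed)
    rwa [Set.sdiff_union_sdiff_cancel hAA₁ hAA₂, Set.sdiff_union_sdiff_cancel hBB₁ hBB₂] at this
  choose next h1 h2 h3 h4 h5 using step
  let seq : ℕ → State := fun n => Nat.rec ⟨⟨A, B⟩, hA, hB, hAB, hx₀, hy₀⟩ next n
  have hseq : ∀ n, seq (n + 1) = next n (seq n) := fun n => rfl
  have shrink : ∀ (C W : ℕ → Set X) (c : X), (nhds c).HasAntitoneBasis W → (∀ n, c ∈ C n) →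
      (∀ n, C (n + 1) ⊆ W n) → ⋂ n, C n = {c} := by
    intro C W c hW hc hCW
    refine Set.Subset.antisymm (fun x hx => ?_) (Set.singleton_subset_iff.2 (Set.mem_iInter.2 hc))
    by_contra hne
    obtain ⟨n, hn⟩ := hW.mem_iff.1 (isOpen_compl_singleton.mem_nhds (Ne.symm hne))
    exact hn (hCW n (Set.mem_iInter.1 hx (n + 1))) rfl
  refine orbitEquiv_of_antitone (A := fun n => (seq n).1.1) (B := fun n => (seq n).1.2)
    (x₀ := x₀) (y₀ := y₀) (fun n => (seq n).2.1) (antitone_nat_of_succ_le fun n => h1 n _)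
    (antitone_nat_of_succ_le fun n => h2 n _)
    (shrink _ U x₀ hU (fun n => (seq n).2.2.2.2.1) fun n => h3 n _)
    (shrink _ V y₀ hV (fun n => (seq n).2.2.2.2.2) fun n => h4 n _) (fun W hW => ?_) ⟨k, rfl⟩
    (fun n => h5 n _)
  obtain ⟨n, hn⟩ := hV.mem_iff.1 hW
  exact ⟨n + 1, (h4 n _).trans hn⟩

end


section

variable {X : Type u} [TopologicalSpace X] [MeasurableSpace X] [BorelSpace X]

/-! ### Elements of finite order in the full group -/

lemma IsMinimalHomeo.measure_pos {φ : X ≃ₜ X} (hmin : IsMinimalHomeo φ) {μ : Measure X}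
    [IsProbabilityMeasure μ] (hφ : MeasurePreserving φ μ μ) (U : Set X) (hU : IsOpen U)
    (hne : U.Nonempty) : 0 < μ U := by
  rw [pos_iff_ne_zero]
  intro h0
  have hcov : Set.univ ⊆ ⋃ n : ℤ, (φ ^ n : X ≃ₜ X) ⁻¹' U := fun x _ => by
    obtain ⟨_, hy, n, rfl⟩ := (hmin x).inter_open_nonempty U hU hne
    exact Set.mem_iUnion.2 ⟨n, hy⟩
  have h1 := measure_mono_null hcov (measure_iUnion_null fun n => by
    rw [(measurePreserving_zpow hφ n).measure_preimage hU.measurableSet.nullMeasurableSet, h0])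
  rw [measure_univ] at h1
  exact one_ne_zero h1

lemma IsMinimalHomeo.measure_singleton [T1Space X] [PerfectSpace X] {φ : X ≃ₜ X}
    (hmin : IsMinimalHomeo φ) {μ : Measure X} [IsProbabilityMeasure μ]
    (hφ : MeasurePreserving φ μ μ) (x : X) : μ {x} = 0 := by
  by_contra hx
  have hinf : (Set.range fun n : ℤ => (φ ^ n) x).Infinite := by
    intro hfin
    have huniv : Set.range (fun n : ℤ => (φ ^ n) x) = Set.univ := by
      rw [← hfin.isClosed.closure_eq]
      exact (hmin x).closure_eq
    rw [huniv] at hfin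
    have hopen : IsOpen ({x} : Set X) := by
      rw [← isClosed_compl_iff]
      exact (hfin.subset (Set.subset_univ _)).isClosed
    obtain ⟨y, hy, hyx⟩ := preperfect_iff_nhds.1 PerfectSpace.univ_preperfect x (Set.mem_univ x)
      {x} (hopen.mem_nhds rfl)
    exact hyx hy.1
  refine measure_ne_top μ _ (hinf.meas_eq_top ⟨μ {x}, hx, ?_⟩)
  rintro _ ⟨n, rfl⟩
  rw [← measure_zpow_image hφ n {x}, Set.image_singleton]

/-- The elements of the full group preserve the invariant measures. -/
lemma measure_image_of_mem_fullGroup [CompactSpace X] [T2Space X] {φ g : X ≃ₜ X}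
    (hg : g ∈ fullGroup φ) {μ : Measure X} (hφ : MeasurePreserving φ μ μ) {U : Set X}
    (hU : IsClosed U) : μ (g '' U) = μ U :=
  (OrbitEquiv.measure_eq hφ hU (g.isClosed_image.2 hU)
    ⟨g, g.continuous.continuousOn, g.injective.injOn.bijOn_image, fun x _ => hg x⟩).symm

/-- A permutation `σ` of the pieces of a finite clopen partition `p`, such that pieces in the same
`σ`-orbit are orbit equivalent, is induced by an element of finite order of the full group.

Each piece `i` is identified with a piece `r i` depending on the `σ`-orbit only; with respect to
these identifications, the element acts by `σ` alone. -/
lemma exists_isOfFinOrder_of_perm {X : Type u} [TopologicalSpace X] [CompactSpace X] [T2Space X]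
    [Nonempty X] {φ : X ≃ₜ X} {I : Type*} [Finite I] {p : X → I} (hp : ∀ i, IsClopen (p ⁻¹' {i}))
    (σ : Equiv.Perm I) (r : I → I) (hr : ∀ i, r (σ i) = r i)
    (he : ∀ i, OrbitEquiv φ (p ⁻¹' {r i}) (p ⁻¹' {i})) :
    ∃ h : fullGroup φ, IsOfFinOrder h ∧ ∀ x, p ((h : X ≃ₜ X) x) = σ (p x) := by
  choose g hgc hgb hgo using he
  let g' (i : I) : X → X := Function.invFunOn (g i) (p ⁻¹' {r i})
  have hgc' : ∀ i, ContinuousOn (g' i) (p ⁻¹' {i}) := fun i =>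
    continuousOn_invFunOn (hp _).isClosed (hgc i) (hgb i)
  have hm' : ∀ i, Set.MapsTo (g' i) (p ⁻¹' {i}) (p ⁻¹' {r i}) := fun i =>
    (hgb i).surjOn.mapsTo_invFunOn
  have hinv : ∀ i, Set.InvOn (g' i) (g i) (p ⁻¹' {r i}) (p ⁻¹' {i}) := fun i =>
    (hgb i).invOn_invFunOn
  -- `F τ` acts by `τ` on the pieces; `τ ↦ F τ` is multiplicative on the powers of `σ`.
  let F (τ : Equiv.Perm I) (x : X) : X := g (τ (p x)) (g' (p x) x)
  have hmem : ∀ τ : Equiv.Perm I, (∀ i, r (τ i) = r i) → ∀ x,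
      g' (p x) x ∈ p ⁻¹' {r (τ (p x))} := fun τ hτ x => by
    rw [hτ]; exact hm' _ rfl
  have hpF : ∀ τ : Equiv.Perm I, (∀ i, r (τ i) = r i) → ∀ x, p (F τ x) = τ (p x) :=
    fun τ hτ x => (hgb _).mapsTo (hmem τ hτ x)
  have hFF : ∀ τ τ' : Equiv.Perm I, (∀ i, r (τ i) = r i) → ∀ x, F τ' (F τ x) = F (τ' * τ) x := by
    intro τ τ' hτ x
    change g (τ' (p (F τ x))) (g' (p (F τ x)) (F τ x)) = _
    rw [hpF τ hτ, show F τ x = g (τ (p x)) (g' (p x) x) from rfl, (hinv _).1 (hmem τ hτ x)]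
    rfl
  have hF1 : ∀ x, F 1 x = x := fun x => (hinv (p x)).2 rfl
  have hFc : ∀ τ : Equiv.Perm I, (∀ i, r (τ i) = r i) → Continuous (F τ) := by
    intro τ hτ
    rw [continuous_iff_continuousAt]
    intro x
    have hnhds : p ⁻¹' {p x} ∈ nhds x := (hp _).isOpen.mem_nhds rfl
    have h1 : ContinuousOn (fun z => g (τ (p x)) (g' (p x) z)) (p ⁻¹' {p x}) :=
      (hgc (τ (p x))).comp (hgc' _) fun z hz => by rw [hτ]; exact hm' _ hz
    refine (h1.continuousAt hnhds).congr ?_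
    filter_upwards [hnhds] with z hz
    have hz : p z = p x := hz
    simp only [F, hz]
  have hr' : ∀ i, r (σ⁻¹ i) = r i := fun i => by
    rw [← hr (σ⁻¹ i), ← Equiv.Perm.mul_apply, mul_inv_cancel, Equiv.Perm.one_apply]
  let h : X ≃ₜ X :=
    { toFun := F σ
      invFun := F σ⁻¹
      left_inv := fun x => by rw [hFF σ _ hr, inv_mul_cancel, hF1]
      right_inv := fun x => by rw [hFF σ⁻¹ _ hr', mul_inv_cancel, hF1]
      continuous_toFun := hFc σ hr
      continuous_invFun := hFc _ hr' }
  have hh : h ∈ fullGroup φ := by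
    intro x
    obtain ⟨n, hn⟩ := exists_zpow_invFunOn (hgb (p x)) (hgo (p x)) x rfl
    obtain ⟨m, hm⟩ := hgo (σ (p x)) _ (hmem σ hr x)
    refine ⟨m + n, ?_⟩
    rw [zpow_add, Homeomorph.mul_apply, ← hn]
    exact hm
  have hpow : ∀ n : ℕ, ∀ x, (h ^ n) x = F (σ ^ n) x := by
    intro n
    induction n with
    | zero => intro x; rw [pow_zero, pow_zero, hF1]; rfl
    | succ n ih =>
      intro x
      rw [pow_succ, Homeomorph.mul_apply, ih, pow_succ, ← hFF σ _ hr]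
      rfl
  refine ⟨⟨h, hh⟩, isOfFinOrder_iff_pow_eq_one.2 ?_, hpF σ hr⟩
  obtain ⟨n, hn, hσn⟩ := (isOfFinOrder_iff_pow_eq_one.1 (isOfFinOrder_of_finite σ))
  refine ⟨n, hn, Subtype.ext (Homeomorph.ext fun x => ?_)⟩
  change (h ^ n) x = x
  rw [hpow, hσn, hF1]

/-- A uniquely ergodic minimal homeomorphism preserves a good measure. -/
lemma isGoodMeasure_of_uniquelyErgodic [CompactSpace X] [MetrizableSpace X] [PerfectSpace X]
    {φ : X ≃ₜ X} (hmin : IsMinimalHomeo φ) {μ : Measure X} [hμ : IsProbabilityMeasure μ]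
    (hφ : MeasurePreserving φ μ μ)
    (huniq : ∀ ν : Measure X, IsProbabilityMeasure ν ∧ MeasurePreserving φ ν ν → ν = μ) :
    IsGoodMeasure μ where
  isProbability := hμ
  atomless := hmin.measure_singleton hφ
  fullSupport := hmin.measure_pos hφ
  subset_property A B hA hB hAB := by
    rcases hAB.eq_or_lt with h | h
    · exact ⟨B, hB, subset_rfl, h.symm⟩
    · obtain ⟨C, hC, hCB, he⟩ := exists_orbitEquiv_subset huniq hA hB h
      exact ⟨C, hC, hCB, (he.measure_eq hφ hA.isClosed hC.isClosed).symm⟩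

lemma dense_isOfFinOrder_fullGroup (hX : IsCantorSpace X) {φ : X ≃ₜ X} (hmin : IsMinimalHomeo φ)
    (hue : IsUniquelyErgodic φ) : Dense {g : fullGroup φ | IsOfFinOrder g} := by
  classical
  have := hX.nonempty
  have := hX.compact
  have := hX.metrizable
  have := hX.perfect
  obtain ⟨μ, ⟨hprob, hφ⟩, huniq⟩ := hue
  have hgood := isGoodMeasure_of_uniquelyErgodic hmin hφ huniq
  rw [dense_iff_inter_open]
  rintro _ ⟨O, hO, rfl⟩ ⟨g, hgO⟩
  obtain ⟨_, ⟨s, ⟨hsfin, hs⟩, rfl⟩, hgs, hsO⟩ :=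
    (isTopologicalBasis_of_subbasis (t := homeoTopology X) rfl).exists_subset_of_mem_open hgO hO
  have := hsfin.to_subtype
  choose U V hU hV hUV using fun T : s => hs T.2
  have hgUV : ∀ T, (g : X ≃ₜ X) '' U T = V T := fun T => by
    have h1 : (g : X ≃ₜ X) ∈ (T : Set (X ≃ₜ X)) := hgs T T.2
    rwa [hUV T] at h1
  have hgmem : ∀ T x, (g : X ≃ₜ X) x ∈ V T ↔ x ∈ U T := fun T x => by
    rw [← hgUV T, (g : X ≃ₜ X).injective.mem_set_image]
  -- Points are labelled by the sets `U T`, respectively `V T`, containing them; `g` carries the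
  -- first labelling to the second.
  let a : X → Set s × Set s := fun x => ({T | x ∈ U T}, {T | x ∈ V T})
  have hset : ∀ W : s → Set X, (∀ T, IsClopen (W T)) → ∀ k : Set s,
      IsClopen {x | {T | x ∈ W T} = k} := by
    intro W hW k
    have h1 : {x | {T | x ∈ W T} = k} = ⋂ T, if T ∈ k then W T else (W T)ᶜ := by
      ext x
      simp only [Set.mem_ofPred_eq, Set.ext_iff, Set.mem_iInter]
      refine forall_congr' fun T => ?_
      by_cases hT : T ∈ k <;> simp [hT]
    rw [h1]
    refine isClopen_iInter_of_finite fun T => ?_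
    split_ifs
    exacts [hW T, (hW T).compl]
  have ha : ∀ i, IsClopen (a ⁻¹' {i}) := by
    rintro ⟨k, l⟩
    have h1 : a ⁻¹' {(k, l)} = {x | {T | x ∈ U T} = k} ∩ {x | {T | x ∈ V T} = l} := by
      ext x; simp [a]
    rw [h1]
    exact (hset U hU k).inter (hset V hV l)
  obtain ⟨I, _, p, q, σ, hp, hpc, hqp, hσ, hσμ⟩ := hgood.exists_refinement_perm ha Prod.fst Prod.snd
    (fun k => by
      have h1 : {x | (a x).2 = k} = (g : X ≃ₜ X) '' {x | (a x).1 = k} := by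
        ext x
        obtain ⟨z, rfl⟩ := (g : X ≃ₜ X).surjective x
        rw [(g : X ≃ₜ X).injective.mem_set_image]
        simp [a, hgmem]
      rw [Measure.real, Measure.real, h1,
        measure_image_of_mem_fullGroup g.2 hφ (hset U hU k).isClosed])
  have : Nonempty I := (hX.nonempty).map p
  -- The representative of a piece depends only on its measure, which `σ` preserves.
  let r (i : I) : I := Function.invFun (fun i => μ (p ⁻¹' {i})) (μ (p ⁻¹' {i}))
  have hσμ' : ∀ i, μ (p ⁻¹' {σ i}) = μ (p ⁻¹' {i}) := fun i =>
    (ENNReal.toReal_eq_toReal_iff' (measure_ne_top _ _) (measure_ne_top _ _)).1 (hσμ i)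
  have hrμ : ∀ i, μ (p ⁻¹' {r i}) = μ (p ⁻¹' {i}) := fun i =>
    Function.invFun_eq (f := fun i => μ (p ⁻¹' {i})) ⟨i, rfl⟩
  obtain ⟨h, hfin, hh⟩ := exists_isOfFinOrder_of_perm (φ := φ) hpc σ r
    (fun i => by simp only [r, hσμ'])
    (fun i => orbitEquiv_of_measure_eq hX.zeroDim hmin hφ huniq hgood.atomless hgood.fullSupport
      (hpc _) (hpc _) (hrμ i) (hp (r i)))
  refine ⟨h, hsO fun T hT => ?_, hfin⟩
  have hUh : ∀ x, (h : X ≃ₜ X) x ∈ V ⟨T, hT⟩ ↔ x ∈ U ⟨T, hT⟩ := fun x => by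
    have h1 := hσ (p x)
    rw [← hh, hqp, hqp] at h1
    exact Set.ext_iff.1 h1 ⟨T, hT⟩
  rw [show T = _ from hUV ⟨T, hT⟩]
  ext y
  obtain ⟨x, rfl⟩ := (h : X ≃ₜ X).surjective y
  rw [(h : X ≃ₜ X).injective.mem_set_image, hUh]

end

end CantorDynamics

theorem mainTheorem4 {X : Type u} [TopologicalSpace X] [MeasurableSpace X] [BorelSpace X]
    (hX : CantorDynamics.IsCantorSpace X) :
    (∀ φ : X ≃ₜ X, CantorDynamics.IsMinimalHomeo φ → CantorDynamics.IsUniquelyErgodic φ →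
      Dense {g : CantorDynamics.fullGroup φ | IsOfFinOrder g}) ∧
    (∀ μ : Measure X, CantorDynamics.IsGoodMeasure μ →
      CantorDynamics.PartialAutomorphismsExtend μ) :=
  ⟨fun _ hmin hue => CantorDynamics.dense_isOfFinOrder_fullGroup hX hmin hue,
    fun _ hμ => hμ.partialAutomorphismsExtend⟩
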